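/- Let $b=\{b_j\}_{j\ge1}$ be a sequence of real numbers with $0<b_1\le b_2\le\cdots$. For $d\in\mathbb N=\{1,2,\dots\}$ let $L_2([0,1]^d)$ be the space of square-integrable complex functions on the torus $[0,1]^d$, with Fourier coefficients $\hat f(k)=\int_{[0,1]^d}f(x)e^{-2\pi i k\cdot x}\,dx$, $k\in\mathbb Z^d$. For $r>0$ let $D_j^rf$ be the Weyl derivative of order $r$ in $x_j$, with Fourier coefficients $(2\pi i k_j)^r\hat f(k)$, where $(2\pi i m)^r=|2\pi m|^r e^{\frac{r\pi i}{2}\operatorname{sign}m}$. Let $$W_2^b([0,1]^d)=\{f\in L_2([0,1]^d): D_j^{b_j}f\in L_2([0,1]^d),\ j=1,\dots,d\},\qquad \|f\|_{W_2^b}=\Big(\|f\|_2^2+\sum_{j=1}^d\|D_j^{b_j}f\|_2^2\Big)^{1/2},$$ and let $\tilde I=\{\tilde I_d\}_{d\in\mathbb N}$, where $\tilde I_d:W_2^b([0,1]^d)\to L_2([0,1]^d)$, $\tilde I_d(f)=f$. Let $$e(n,\tilde I_d)=\inf_{L_1,\dots,L_n,\ \varphi}\ \sup_{\|f\|_{W_2^b}\le1}\big\|f-\varphi(L_1(f),\dots,L_n(f))\big\|_2$$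 be the $n$-th minimal worst-case error, where $L_1,\dots,L_n$ range over the continuous linear functionals on $W_2^b([0,1]^d)$ and $\varphi$ over all mappings $\mathbb C^n\to L_2([0,1]^d)$. For $\varepsilon\in(0,1)$ let $n(\varepsilon,d)=\min\{n\ge0: e(n,\tilde I_d)\le\varepsilon\}$ (such an $n$ always exists). The problem $\tilde I$ is called - SPT if there are $C,p\ge0$ with $n(\varepsilon,d)\le C\varepsilon^{-p}$ for all $d\in\mathbb N$, $\varepsilon\in(0,1)$; - PT if there are $C,p,q\ge0$ with $n(\varepsilon,d)\le Cd^q\varepsilon^{-p}$ for all $d\in\mathbb N$, $\varepsilon\in(0,1)$; - QPT if there are $C,t>0$ with $n(\varepsilon,d)\le C\exp[t(1+\ln\varepsilon^{-1})(1+\ln d)]$ for all $d\in\mathbb N$, $\varepsilon\in(0,1)$; - $(s,t)$-WT, for $s,t>0$, if $\displaystyle\lim_{\varepsilon^{-1}+d\to\infty}\frac{\ln n(\varepsilon,d)}{\varepsilon^{-s}+d^{t}}=0$; WT if this holds with $s=t=1$; UWT if it holds for all $s,t>0$. Then: 1. $\tilde I$ is SPT iff $\tilde I$ is PT iff $\sum_{j=1}^\infty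 b_j^{-1}<\infty$. 2. $\tilde I$ is QPT iff $\displaystyle\sup_{d\in\mathbb N}\frac{\sum_{j=1}^d b_j^{-1}}{1+\ln d}<\infty$. 3. $\tilde I$ is UWT iff $\displaystyle\lim_{j\to\infty}\frac{b_j}{\ln j}=\infty$. 4. $\tilde I$ is WT iff $\displaystyle\lim_{j\to\infty}\frac{(2\pi)^{2b_j}}{j}=\infty$. 5. $\tilde I$ is $(s,t)$-WT for all $s,t>0$ with $\max(s/2,t)>1$. 6. $\tilde I$ is $(2,1)$-WT iff $\displaystyle\lim_{j\to\infty}b_j=\infty$. 7. For $0<t<1$, $\tilde I$ is $(2,t)$-WT iff $\displaystyle\lim_{j\to\infty}\frac{(2\pi)^{2b_j}}{\ln j}=\infty$. 8. For $0<s<2$ and $0<t\le1$, $\tilde I$ is $(s,t)$-WT iff $\displaystyle\lim_{j\to\infty}\frac{(2\pi)^{2b_j}}{j^{(2-s)/s}}=\infty$. -/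

import Mathlib

open scoped ENNReal
open Filter Topology MeasureTheory

noncomputable section

namespace AnisoTract

/-! ### General notions: algorithms, minimal errors, information complexity, tractability -/

section General

variable {H G : Type*} [NormedAddCommGroup H] [NormedSpace ℂ H]
  [NormedAddCommGroup G] [NormedSpace ℂ G]

/-- Worst-case error, over the closed unit ball of `H`, of the algorithm
`f ↦ φ (L₁ f, …, Lₙ f)` for the approximation of `S : H → G`.
It may be infinite, since `φ` is an arbitrary mapping. -/
def worstCaseError (S : H →L[ℂ] G) {n : ℕ} (L : Fin n → (H →L[ℂ] ℂ))
    (φ : (Fin n → ℂ) → G) : ℝ≥0∞ :=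
  ⨆ f ∈ Metric.closedBall (0 : H) 1, ‖S f - φ (fun i => L i f)‖ₑ

/-- The `n`-th minimal worst-case error `e(n, S)`: the infimum over all algorithms that use `n`
continuous linear functionals and an arbitrary mapping. (For `n = 0` the algorithms are the
constants; by symmetry of the unit ball the zero algorithm is an optimal one among them, so
`e(0, S)` is the initial error `‖S‖`.) -/
def minimalError (n : ℕ) (S : H →L[ℂ] G) : ℝ≥0∞ :=
  ⨅ (L : Fin n → (H →L[ℂ] ℂ)) (φ : (Fin n → ℂ) → G), worstCaseError S L φ

/-- The information complexity `n(ε, S) = min {n : e(n, S) ≤ ε}`. -/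
def infoComplexity (ε : ℝ) (S : H →L[ℂ] G) : ℕ :=
  sInf {n : ℕ | minimalError n S ≤ ENNReal.ofReal ε}

end General

section Tractability

/-- The filter "`ε⁻¹ + d → ∞`" on pairs `(ε, d)` with `ε ∈ (0, 1)` and `d ≥ 1`. -/
def tractFilter : Filter (ℝ × ℕ) :=
  comap (fun p : ℝ × ℕ => p.1⁻¹ + (p.2 : ℝ)) atTop ⊓
    𝓟 {p : ℝ × ℕ | 0 < p.1 ∧ p.1 < 1 ∧ 1 ≤ p.2}

variable {H G : ℕ → Type*} [∀ d, NormedAddCommGroup (H d)] [∀ d, NormedSpace ℂ (H d)]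
  [∀ d, NormedAddCommGroup (G d)] [∀ d, NormedSpace ℂ (G d)]

/-- Strong polynomial tractability. -/
def IsSPT (S : ∀ d, H d →L[ℂ] G d) : Prop :=
  ∃ C p : ℝ, 0 ≤ C ∧ 0 ≤ p ∧ ∀ d : ℕ, 1 ≤ d → ∀ ε : ℝ, 0 < ε → ε < 1 →
    (infoComplexity ε (S d) : ℝ) ≤ C * ε⁻¹ ^ p

/-- Polynomial tractability. -/
def IsPT (S : ∀ d, H d →L[ℂ] G d) : Prop :=
  ∃ C p q : ℝ, 0 ≤ C ∧ 0 ≤ p ∧ 0 ≤ q ∧ ∀ d : ℕ, 1 ≤ d → ∀ ε : ℝ, 0 < ε → ε < 1 →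
    (infoComplexity ε (S d) : ℝ) ≤ C * (d : ℝ) ^ q * ε⁻¹ ^ p

/-- Quasi-polynomial tractability. -/
def IsQPT (S : ∀ d, H d →L[ℂ] G d) : Prop :=
  ∃ C t : ℝ, 0 < C ∧ 0 < t ∧ ∀ d : ℕ, 1 ≤ d → ∀ ε : ℝ, 0 < ε → ε < 1 →
    (infoComplexity ε (S d) : ℝ) ≤
      C * Real.exp (t * (1 + Real.log ε⁻¹) * (1 + Real.log d))

/-- `(s, t)`-weak tractability (used for positive `s` and `t`). -/
def IsWTst (s t : ℝ) (S : ∀ d, H d →L[ℂ] G d) : Prop :=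
  Tendsto (fun p : ℝ × ℕ => Real.log (infoComplexity p.1 (S p.2)) /
    (p.1⁻¹ ^ s + (p.2 : ℝ) ^ t)) tractFilter (𝓝 0)

/-- Weak tractability. -/
def IsWT (S : ∀ d, H d →L[ℂ] G d) : Prop :=
  Tendsto (fun p : ℝ × ℕ => Real.log (infoComplexity p.1 (S p.2)) /
    (p.1⁻¹ + (p.2 : ℝ))) tractFilter (𝓝 0)

/-- Uniform weak tractability. -/
def IsUWT (S : ∀ d, H d →L[ℂ] G d) : Prop :=
  ∀ α β : ℝ, 0 < α → 0 < β →
    Tendsto (fun p : ℝ × ℕ => Real.log (infoComplexity p.1 (S p.2)) /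
      (p.1⁻¹ ^ α + (p.2 : ℝ) ^ β)) tractFilter (𝓝 0)

end Tractability

/-! ### Anisotropic Sobolev spaces on the torus `[0,1]^d` -/

section Sobolev

/-- Lebesgue measure on the circle `ℝ / ℤ`, of total mass one (the normalisation used by
`UnitAddTorus.mFourierCoeff`). -/
local instance : MeasureSpace UnitAddCircle := ⟨AddCircle.haarAddCircle⟩

/-- `L₂([0,1]^d)`, complex valued, with `[0,1]^d` regarded as the torus `(ℝ/ℤ)^d`. -/
abbrev L2Torus (d : ℕ) : Type := Lp ℂ 2 (volume : Measure (UnitAddTorus (Fin d)))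

/-- The Fourier coefficient `f̂(k) = ∫ f(x) exp(-2πi k·x) dx`. -/
def fourierCoeff {d : ℕ} (f : L2Torus d) (k : Fin d → ℤ) : ℂ :=
  UnitAddTorus.mFourierCoeff f k

/-- The Weyl symbol `(2πik)^r = |2πk|^r exp ((rπi/2) sign k)`. -/
def weylSymbol (r : ℝ) (k : ℤ) : ℂ :=
  ((|2 * Real.pi * (k : ℝ)| ^ r : ℝ) : ℂ) *
    Complex.exp ((r : ℂ) * (Real.pi : ℂ) * Complex.I / 2 * ((Int.sign k : ℤ) : ℂ))

/-- `g` is the Weyl derivative of order `r` of `f` with respect to the `j`-th variable, i.e.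
`g = ∑ₖ (2πikⱼ)^r f̂(k) exp(2πi k·x)` in `L₂`. -/
def IsWeylDeriv {d : ℕ} (r : ℝ) (j : Fin d) (f g : L2Torus d) : Prop :=
  ∀ k : Fin d → ℤ, fourierCoeff g k = weylSymbol r (k j) * fourierCoeff f k

lemma fourierCoeff_eq_repr {d : ℕ} (f : L2Torus d) (k : Fin d → ℤ) :
    fourierCoeff f k = UnitAddTorus.mFourierBasis.repr f k :=
  (UnitAddTorus.mFourierBasis_repr f k).symm

lemma fourierCoeff_add {d : ℕ} (f g : L2Torus d) (k : Fin d → ℤ) :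
    fourierCoeff (f + g) k = fourierCoeff f k + fourierCoeff g k := by
  simp [fourierCoeff_eq_repr]

lemma fourierCoeff_smul {d : ℕ} (c : ℂ) (f : L2Torus d) (k : Fin d → ℤ) :
    fourierCoeff (c • f) k = c * fourierCoeff f k := by
  simp [fourierCoeff_eq_repr]

lemma fourierCoeff_zero {d : ℕ} (k : Fin d → ℤ) : fourierCoeff (0 : L2Torus d) k = 0 := by
  simp [fourierCoeff_eq_repr]

lemma fourierCoeff_injective {d : ℕ} {f g : L2Torus d}
    (h : ∀ k, fourierCoeff f k = fourierCoeff g k) : f = g := by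
  apply UnitAddTorus.mFourierBasis.repr.injective
  ext k
  simpa [fourierCoeff_eq_repr] using h k

lemma IsWeylDeriv.unique {d : ℕ} {r : ℝ} {j : Fin d} {f g g' : L2Torus d}
    (h : IsWeylDeriv r j f g) (h' : IsWeylDeriv r j f g') : g = g' :=
  fourierCoeff_injective fun k => (h k).trans (h' k).symm

lemma IsWeylDeriv.add {d : ℕ} {r : ℝ} {j : Fin d} {f g f' g' : L2Torus d}
    (h : IsWeylDeriv r j f g) (h' : IsWeylDeriv r j f' g') :
    IsWeylDeriv r j (f + f') (g + g') := fun k => by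
  rw [fourierCoeff_add, fourierCoeff_add, h k, h' k, mul_add]

lemma IsWeylDeriv.smul {d : ℕ} {r : ℝ} {j : Fin d} {f g : L2Torus d} (c : ℂ)
    (h : IsWeylDeriv r j f g) : IsWeylDeriv r j (c • f) (c • g) := fun k => by
  rw [fourierCoeff_smul, fourierCoeff_smul, h k, mul_left_comm]

/-- The functions `f ∈ L₂([0,1]^d)` with `D_j^{b_j} f ∈ L₂([0,1]^d)` for `j = 1, …, d`.
The sequence `b` is indexed from `1`; the coordinate `j : Fin d` carries the exponent
`b (j + 1)`, and `b 0` is not used. -/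
def sobolevSubmodule (b : ℕ → ℝ) (d : ℕ) : Submodule ℂ (L2Torus d) where
  carrier := {f | ∀ j : Fin d, ∃ g : L2Torus d, IsWeylDeriv (b (j + 1)) j f g}
  zero_mem' := fun j => ⟨0, fun k => by simp [fourierCoeff_zero]⟩
  add_mem' := fun hf hg j => by
    obtain ⟨u, hu⟩ := hf j
    obtain ⟨v, hv⟩ := hg j
    exact ⟨u + v, hu.add hv⟩
  smul_mem' := fun c f hf j => by
    obtain ⟨u, hu⟩ := hf j
    exact ⟨c • u, hu.smul c⟩

/-- The anisotropic Sobolev space `W_2^b([0,1]^d)`; it gets its own norm below. -/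
def Sobolev (b : ℕ → ℝ) (d : ℕ) : Type := sobolevSubmodule b d

instance (b : ℕ → ℝ) (d : ℕ) : AddCommGroup (Sobolev b d) :=
  inferInstanceAs (AddCommGroup (sobolevSubmodule b d))

instance (b : ℕ → ℝ) (d : ℕ) : Module ℂ (Sobolev b d) :=
  inferInstanceAs (Module ℂ (sobolevSubmodule b d))

/-- The underlying `L₂` function. -/
def Sobolev.toL2 (b : ℕ → ℝ) (d : ℕ) : Sobolev b d →ₗ[ℂ] L2Torus d :=
  (sobolevSubmodule b d).subtype

/-- The Weyl derivative `D_j^{b_j} f ∈ L₂` of `f` in the Sobolev space. -/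
def Sobolev.deriv {b : ℕ → ℝ} {d : ℕ} (j : Fin d) (f : Sobolev b d) : L2Torus d :=
  Classical.choose (f.2 j)

lemma Sobolev.deriv_spec {b : ℕ → ℝ} {d : ℕ} (j : Fin d) (f : Sobolev b d) :
    IsWeylDeriv (b (j + 1)) j (Sobolev.toL2 b d f) (Sobolev.deriv j f) :=
  Classical.choose_spec (f.2 j)

/-- `f ↦ (f, (D_1^{b_1} f, …, D_d^{b_d} f))`, with values in a Hilbert sum of copies of `L₂`. -/
def Sobolev.graph (b : ℕ → ℝ) (d : ℕ) :
    Sobolev b d →ₗ[ℂ] WithLp 2 (L2Torus d × PiLp 2 (fun _ : Fin d => L2Torus d)) where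
  toFun f := WithLp.toLp 2
    (Sobolev.toL2 b d f, WithLp.toLp 2 (fun j => Sobolev.deriv j f))
  map_add' f g := by
    have h : (fun j => Sobolev.deriv j (f + g)) =
        (fun j => Sobolev.deriv j f) + fun j => Sobolev.deriv j g := by
      funext j
      have h2 := (Sobolev.deriv_spec j f).add (Sobolev.deriv_spec j g)
      rw [← map_add] at h2
      exact (Sobolev.deriv_spec j (f + g)).unique h2
    rw [h, map_add, WithLp.toLp_add]
    rfl
  map_smul' c f := by
    have h : (fun j => Sobolev.deriv j (c • f)) = c • fun j => Sobolev.deriv j f := by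
      funext j
      have h2 := (Sobolev.deriv_spec j f).smul c
      rw [← map_smul] at h2
      exact (Sobolev.deriv_spec j (c • f)).unique h2
    rw [h, map_smul, WithLp.toLp_smul]
    rfl

lemma Sobolev.graph_injective (b : ℕ → ℝ) (d : ℕ) :
    Function.Injective (Sobolev.graph b d) := fun f g h => by
  have h1 : Sobolev.toL2 b d f = Sobolev.toL2 b d g :=
    congrArg (fun x => (WithLp.ofLp x).1) h
  exact Subtype.ext h1

/-- The norm of `W_2^b([0,1]^d)` is the graph norm; see `Sobolev.norm_eq` for the formula. -/
instance (b : ℕ → ℝ) (d : ℕ) : NormedAddCommGroup (Sobolev b d) :=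
  NormedAddCommGroup.induced _ _ (Sobolev.graph b d) (Sobolev.graph_injective b d)

instance (b : ℕ → ℝ) (d : ℕ) : NormedSpace ℂ (Sobolev b d) :=
  NormedSpace.induced ℂ _ _ (Sobolev.graph b d)

/-- `‖f‖_W = (‖f‖₂² + ∑ⱼ ‖D_j^{b_j} f‖₂²)^{1/2}`. -/
lemma Sobolev.norm_eq {b : ℕ → ℝ} {d : ℕ} (f : Sobolev b d) :
    ‖f‖ = Real.sqrt (‖Sobolev.toL2 b d f‖ ^ 2 + ∑ j : Fin d, ‖Sobolev.deriv j f‖ ^ 2) := by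
  have h : ‖f‖ = ‖Sobolev.graph b d f‖ := rfl
  rw [h, WithLp.prod_norm_eq_of_L2, PiLp.norm_sq_eq_of_L2]
  rfl

/-- The embedding `W_2^b([0,1]^d) → L₂([0,1]^d)`, `f ↦ f`. -/
def sobolevEmbedding (b : ℕ → ℝ) (d : ℕ) : Sobolev b d →L[ℂ] L2Torus d :=
  (Sobolev.toL2 b d).mkContinuous 1 fun f => by
    rw [one_mul, Sobolev.norm_eq]
    apply Real.le_sqrt_of_sq_le
    have : 0 ≤ ∑ j : Fin d, ‖Sobolev.deriv j f‖ ^ 2 := by positivity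
    linarith

end Sobolev

end AnisoTract

end

/-! By Parseval the embedding is diagonal in the Fourier basis: `‖f‖² = ∑ₖ w(k) |f̂(k)|²` with `w =
sobolevWeight b` (`Sobolev.hasSum_norm_sq`). Hence `n(ε, d)` is the number of `k` with `w(k) < ε⁻²`
(`infoComplexity_sobolevEmbedding`), and every claim becomes a counting estimate. Write `u = ε⁻¹`,
`X = u²`, `c_j = (2π)^(2 b_j)`.

Polynomial notions: comparison with boxes bounds the count above by `u ^ ∑ 1/b_j`, with constant 1
for every `d`, and below by the same power with a constant depending on `d`. Letting `u → ∞` with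
`d` fixed compares exponents only, so that constant is harmless.

Weak notions, necessity: 0-1 vectors with at most `m` ones have weight at most `1 + m c_d`. Counting
all `2^d` of them, or `d.choose m` of them, contradicts tractability when `c_d` is too small.

Weak notions, sufficiency: a Chernoff bound (`exists_log_card_frequencies_le`) gives `log N ≤ l X +
∑ⱼ laplaceTerm C A (l c_j)` for every `l > 0`, and each term is at most a constant times `(l
c_j)^(-a)` for any chosen `a > 0`. The cases differ in the choice of `l`: `u⁻²` for `t > 1` and for
UWT, `1 + 2 log d` for `s > 2`, a constant `η` for `s = 2`, and `η u^(s-2)` for `s < 2`. -/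

noncomputable section

namespace AnisoTract


/-! ### Parseval for the Sobolev norm -/

section Fourier

/-- The Fourier weight of `W_2^b`: `1 + ∑ⱼ |2πkⱼ|^{2bⱼ}`. -/
def sobolevWeight (b : ℕ → ℝ) {d : ℕ} (k : Fin d → ℤ) : ℝ :=
  1 + ∑ j : Fin d, |2 * Real.pi * (k j : ℝ)| ^ (2 * b (j + 1))

lemma one_le_sobolevWeight (b : ℕ → ℝ) {d : ℕ} (k : Fin d → ℤ) : 1 ≤ sobolevWeight b k := by
  have : 0 ≤ ∑ j : Fin d, |2 * Real.pi * (k j : ℝ)| ^ (2 * b (j + 1)) := by positivity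
  unfold sobolevWeight
  linarith

lemma norm_weylSymbol (r : ℝ) (k : ℤ) : ‖weylSymbol r k‖ = |2 * Real.pi * (k : ℝ)| ^ r := by
  have h : ((r : ℂ) * (Real.pi : ℂ) * Complex.I / 2 * ((Int.sign k : ℤ) : ℂ)) =
      ((r * Real.pi / 2 * (Int.sign k : ℤ) : ℝ) : ℂ) * Complex.I := by
    push_cast
    ring
  rw [weylSymbol, norm_mul, h, Complex.norm_exp_ofReal_mul_I, mul_one, Complex.norm_real,
    Real.norm_of_nonneg (by positivity)]

lemma hasSum_norm_fourierCoeff_sq {d : ℕ} (f : L2Torus d) :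
    HasSum (fun k => ‖fourierCoeff f k‖ ^ 2) (‖f‖ ^ 2) := by
  have h := lp.hasSum_norm (p := 2) (by simp) (UnitAddTorus.mFourierBasis.repr f)
  simpa [fourierCoeff_eq_repr] using h

/-- Parseval applied to `f` and to each Weyl derivative; the phase of the symbol has modulus one and
disappears. This diagonalises the embedding. -/
lemma Sobolev.hasSum_norm_sq {b : ℕ → ℝ} {d : ℕ} (f : Sobolev b d) :
    HasSum (fun k => sobolevWeight b k * ‖fourierCoeff (Sobolev.toL2 b d f) k‖ ^ 2)
      (‖f‖ ^ 2) := by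
  have h := (hasSum_norm_fourierCoeff_sq (Sobolev.toL2 b d f)).add
    (hasSum_sum (s := Finset.univ) fun (j : Fin d) _ =>
      hasSum_norm_fourierCoeff_sq (Sobolev.deriv j f))
  rw [Sobolev.norm_eq, Real.sq_sqrt (by positivity)]
  convert h using 2 with k
  rw [sobolevWeight, add_mul, one_mul, Finset.sum_mul]
  congr 1
  refine Finset.sum_congr rfl fun j _ => ?_
  rw [Sobolev.deriv_spec j f k, norm_mul, norm_weylSymbol, mul_pow, mul_comm 2 (b _),
    Real.rpow_mul (abs_nonneg _)]
  norm_cast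

lemma fourierCoeff_mFourierBasis {d : ℕ} (l k : Fin d → ℤ) :
    fourierCoeff (UnitAddTorus.mFourierBasis l : L2Torus d) k = if k = l then 1 else 0 := by
  rw [fourierCoeff_eq_repr, HilbertBasis.repr_self, lp.single_apply, Pi.single_apply]

lemma fourierCoeff_sub {d : ℕ} (f g : L2Torus d) (k : Fin d → ℤ) :
    fourierCoeff (f - g) k = fourierCoeff f k - fourierCoeff g k := by
  simp [fourierCoeff_eq_repr]

lemma fourierCoeff_sum {d : ℕ} {ι : Type*} (s : Finset ι) (f : ι → L2Torus d) (k : Fin d → ℤ) :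
    fourierCoeff (∑ i ∈ s, f i) k = ∑ i ∈ s, fourierCoeff (f i) k := by
  induction s using Finset.cons_induction with
  | empty => simp [fourierCoeff_zero]
  | cons i s hi ih => rw [Finset.sum_cons, Finset.sum_cons, fourierCoeff_add, ih]

/-- The exponential `x ↦ exp (2πi l·x)` as an element of the Sobolev space. -/
def Sobolev.exponential (b : ℕ → ℝ) {d : ℕ} (l : Fin d → ℤ) : Sobolev b d :=
  ⟨UnitAddTorus.mFourierBasis l, fun j =>
    ⟨weylSymbol (b (j + 1)) (l j) • UnitAddTorus.mFourierBasis l, fun k => by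
      rw [fourierCoeff_smul, fourierCoeff_mFourierBasis]
      split_ifs with h
      · rw [h]
      · simp⟩⟩

lemma Sobolev.toL2_exponential (b : ℕ → ℝ) {d : ℕ} (l : Fin d → ℤ) :
    Sobolev.toL2 b d (Sobolev.exponential b l) = UnitAddTorus.mFourierBasis l := rfl

lemma norm_fourierCoeff_le {d : ℕ} (f : L2Torus d) (k : Fin d → ℤ) : ‖fourierCoeff f k‖ ≤ ‖f‖ := by
  have h1 : ‖fourierCoeff f k‖ ^ 2 ≤ ‖f‖ ^ 2 :=
    le_hasSum (hasSum_norm_fourierCoeff_sq f) k fun _ _ => sq_nonneg _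
  exact le_of_sq_le_sq h1 (norm_nonneg _)

/-- The Fourier coefficient as a continuous functional on `L₂`. -/
def fourierCoeffCLM {d : ℕ} (k : Fin d → ℤ) : L2Torus d →L[ℂ] ℂ :=
  LinearMap.mkContinuous
    { toFun := fun f => fourierCoeff f k
      map_add' := fun f g => fourierCoeff_add f g k
      map_smul' := fun c f => fourierCoeff_smul c f k } 1 fun f => by
    rw [one_mul]
    exact norm_fourierCoeff_le f k

/-- The Fourier coefficient as a continuous functional on the Sobolev space. -/
def Sobolev.coeffCLM (b : ℕ → ℝ) {d : ℕ} (k : Fin d → ℤ) : Sobolev b d →L[ℂ] ℂ :=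
  (fourierCoeffCLM k).comp (sobolevEmbedding b d)

lemma sobolevEmbedding_apply (b : ℕ → ℝ) (d : ℕ) (f : Sobolev b d) :
    sobolevEmbedding b d f = Sobolev.toL2 b d f := rfl

end Fourier

/-! ### Minimal errors from spectral projections and kernels -/

section MinimalError

/-- Projecting on finitely many frequencies bounds the minimal error from above. -/
lemma minimalError_card_le (b : ℕ → ℝ) {d : ℕ} (B : Finset (Fin d → ℤ)) {ε : ℝ} (hε : 0 < ε)
    (hB : ∀ k ∉ B, ε⁻¹ ^ 2 ≤ sobolevWeight b k) :
    minimalError B.card (sobolevEmbedding b d) ≤ ENNReal.ofReal ε := by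
  refine iInf₂_le_of_le (fun i => Sobolev.coeffCLM b (B.equivFin.symm i : Fin d → ℤ))
    (fun y => ∑ i, y i • (UnitAddTorus.mFourierBasis (B.equivFin.symm i : Fin d → ℤ) : L2Torus d))
    ?_
  refine iSup₂_le fun f hf => ?_
  rw [mem_closedBall_zero_iff] at hf
  rw [← ofReal_norm]
  refine ENNReal.ofReal_le_ofReal ?_
  rw [sobolevEmbedding_apply]
  have hsum : ∑ i, Sobolev.coeffCLM b (B.equivFin.symm i : Fin d → ℤ) f •
      (UnitAddTorus.mFourierBasis (B.equivFin.symm i : Fin d → ℤ) : L2Torus d) =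
      ∑ k ∈ B, fourierCoeff (Sobolev.toL2 b d f) k •
        (UnitAddTorus.mFourierBasis k : L2Torus d) := by
    rw [← Finset.sum_coe_sort B]
    exact Equiv.sum_comp B.equivFin.symm fun k : B =>
      fourierCoeff (Sobolev.toL2 b d f) k • (UnitAddTorus.mFourierBasis (k : Fin d → ℤ) : L2Torus d)
  beta_reduce
  rw [hsum]
  set g := Sobolev.toL2 b d f - ∑ k ∈ B, fourierCoeff (Sobolev.toL2 b d f) k •
        (UnitAddTorus.mFourierBasis k : L2Torus d) with hg
  have hcoeff : ∀ k, fourierCoeff g k = if k ∈ B then 0 else fourierCoeff (Sobolev.toL2 b d f) k := by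
    intro k
    rw [hg, fourierCoeff_sub, fourierCoeff_sum]
    simp only [fourierCoeff_smul, fourierCoeff_mFourierBasis, mul_ite, mul_one, mul_zero,
      Finset.sum_ite_eq]
    split_ifs <;> simp
  have h1 := hasSum_norm_fourierCoeff_sq g
  have h2 := (Sobolev.hasSum_norm_sq f).mul_left (ε ^ 2)
  -- Term by term: the coefficient of `g` vanishes on `B`, and off `B` the weight is at least `ε⁻²`.
  have h3 : ‖g‖ ^ 2 ≤ ε ^ 2 * ‖f‖ ^ 2 := by
    refine hasSum_le (fun k => ?_) h1 h2
    rw [hcoeff]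
    split_ifs with hk
    · have := one_le_sobolevWeight b k
      rw [norm_zero, zero_pow two_ne_zero]
      positivity
    · have h4 : 1 ≤ ε ^ 2 * sobolevWeight b k := by
        have := mul_le_mul_of_nonneg_left (hB k hk) (sq_nonneg ε)
        rwa [← mul_pow, mul_inv_cancel₀ hε.ne', one_pow] at this
      rw [← mul_assoc]
      exact le_mul_of_one_le_left (sq_nonneg _) h4
  refine le_of_sq_le_sq (h3.trans ?_) hε.le
  exact mul_le_of_le_one_right (sq_nonneg _) (pow_le_one₀ (norm_nonneg _) hf)

/-- If `n` functionals vanish at `f` in the unit ball, every algorithm using them has error at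
least `‖S f‖`. -/
lemma enorm_le_worstCaseError {H G : Type*} [NormedAddCommGroup H] [NormedSpace ℂ H]
    [NormedAddCommGroup G] [NormedSpace ℂ G] (S : H →L[ℂ] G) {n : ℕ} (L : Fin n → (H →L[ℂ] ℂ))
    (φ : (Fin n → ℂ) → G) {f : H} (hf : ‖f‖ ≤ 1) (hL : ∀ i, L i f = 0) :
    ‖S f‖ₑ ≤ worstCaseError S L φ := by
  have h1 : ‖S f - φ (fun i => L i f)‖ₑ ≤ worstCaseError S L φ :=
    le_iSup₂_of_le f (by simpa using hf) le_rfl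
  have h2 : ‖S (-f) - φ (fun i => L i (-f))‖ₑ ≤ worstCaseError S L φ :=
    le_iSup₂_of_le (-f) (by simpa using hf) le_rfl
  have h0 : (fun i => L i f) = 0 := funext hL
  have h0' : (fun i => L i (-f)) = 0 := funext fun i => by simp [hL i]
  rw [h0] at h1
  rw [h0', map_neg] at h2
  rw [← ofReal_norm] at h1 h2 ⊢
  -- Both `f` and `-f` produce the data `0`, and `S f` is half the difference of the two errors, so
  -- one of them is at least `‖S f‖`.
  have h3 : ‖S f‖ ≤ max ‖S f - φ 0‖ ‖-S f - φ 0‖ := by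
    have h4 : (2 : ℝ) * ‖S f‖ ≤ ‖S f - φ 0‖ + ‖-S f - φ 0‖ := by
      have h5 := norm_sub_le (S f - φ 0) (-S f - φ 0)
      have h6 : (S f - φ 0) - (-S f - φ 0) = (2 : ℂ) • S f := by
        rw [two_smul]
        abel
      rw [h6, norm_smul] at h5
      simpa using h5
    rcases le_total ‖S f - φ 0‖ ‖-S f - φ 0‖ with h | h
    · rw [max_eq_right h]; linarith
    · rw [max_eq_left h]; linarith
  rcases max_choice ‖S f - φ 0‖ ‖-S f - φ 0‖ with h | h
  · rw [h] at h3
    exact (ENNReal.ofReal_le_ofReal h3).trans h1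
  · rw [h] at h3
    exact (ENNReal.ofReal_le_ofReal h3).trans h2

/-- A set of more than `n` frequencies of weight at most `w` bounds the minimal error from below. -/
lemma le_minimalError (b : ℕ → ℝ) {d n : ℕ} (B : Finset (Fin d → ℤ)) (hn : n < B.card) {w : ℝ}
    (hw : 0 < w) (hB : ∀ k ∈ B, sobolevWeight b k ≤ w) :
    ENNReal.ofReal (√w)⁻¹ ≤ minimalError n (sobolevEmbedding b d) := by
  refine le_iInf₂ fun L φ => ?_
  let E : (B → ℂ) →ₗ[ℂ] Sobolev b d :=
    Fintype.linearCombination ℂ fun k : B => Sobolev.exponential b (k : Fin d → ℤ)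
  let T : (B → ℂ) →ₗ[ℂ] (Fin n → ℂ) := LinearMap.pi fun i => (L i).toLinearMap ∘ₗ E
  -- A trigonometric polynomial with spectrum in `B` has more than `n` free coefficients, so a
  -- nonzero choice is annihilated by all `n` functionals.
  have hker : LinearMap.ker T ≠ ⊥ := T.ker_ne_bot_of_finrank_lt (by simpa using hn)
  obtain ⟨a, ha, ha0⟩ := (Submodule.ne_bot_iff _).1 hker
  set f : Sobolev b d := E a with hf
  have hLf : ∀ i, L i f = 0 := fun i => congrFun (LinearMap.mem_ker.1 ha) i
  have hcoeff : ∀ k, fourierCoeff (Sobolev.toL2 b d f) k =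
      if h : k ∈ B then a ⟨k, h⟩ else 0 := by
    intro k
    rw [hf, Fintype.linearCombination_apply, map_sum, fourierCoeff_sum]
    simp only [map_smul, fourierCoeff_smul, Sobolev.toL2_exponential, fourierCoeff_mFourierBasis]
    split_ifs with h
    · rw [Finset.sum_eq_single ⟨k, h⟩]
      · simp
      · intro l _ hl
        rw [if_neg, mul_zero]
        rintro rfl
        exact hl rfl
      · simp
    · refine Finset.sum_eq_zero fun l _ => ?_
      rw [if_neg, mul_zero]
      rintro rfl
      exact h l.2
  have h1 : ‖f‖ ^ 2 ≤ w * ‖Sobolev.toL2 b d f‖ ^ 2 := by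
    refine hasSum_le (fun k => ?_) (Sobolev.hasSum_norm_sq f)
      ((hasSum_norm_fourierCoeff_sq (Sobolev.toL2 b d f)).mul_left w)
    by_cases hk : k ∈ B
    · exact mul_le_mul_of_nonneg_right (hB k hk) (sq_nonneg _)
    · simp [hcoeff k, hk]
  have hf0 : f ≠ 0 := by
    intro h0
    refine ha0 (funext fun k => ?_)
    have := hcoeff k
    rw [h0, map_zero, fourierCoeff_zero] at this
    simpa using this.symm
  have hnf : 0 < ‖f‖ := norm_pos_iff.2 hf0
  have h2 : ‖f‖ ≤ √w * ‖Sobolev.toL2 b d f‖ := by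
    refine le_of_sq_le_sq ?_ (by positivity)
    rwa [mul_pow, Real.sq_sqrt hw.le]
  have h3 := enorm_le_worstCaseError (sobolevEmbedding b d) L φ
    (f := ((‖f‖⁻¹ : ℝ) : ℂ) • f) (by
      rw [norm_smul, Complex.norm_real, norm_inv, norm_norm, inv_mul_cancel₀ hnf.ne'])
    (fun i => by rw [map_smul, hLf, smul_zero])
  refine le_trans ?_ h3
  rw [← ofReal_norm]
  refine ENNReal.ofReal_le_ofReal ?_
  rw [map_smul, norm_smul, Complex.norm_real, norm_inv, norm_norm, sobolevEmbedding_apply,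
    inv_mul_eq_div, le_div_iff₀ hnf, inv_mul_le_iff₀ (Real.sqrt_pos.2 hw)]
  exact h2

end MinimalError

/-! ### Information complexity as a frequency count -/

section Counting

lemma abs_lt_rpow_of_sobolevWeight_lt {b : ℕ → ℝ} {d : ℕ} (hb : ∀ j : ℕ, 0 < b (j + 1))
    {X : ℝ} {k : Fin d → ℤ} (hk : sobolevWeight b k < X) (j : Fin d) :
    |2 * Real.pi * (k j : ℝ)| < X ^ (2 * b (j + 1))⁻¹ := by
  have h1 : |2 * Real.pi * (k j : ℝ)| ^ (2 * b (j + 1)) < X := by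
    have := Finset.single_le_sum (f := fun j : Fin d => |2 * Real.pi * (k j : ℝ)| ^ (2 * b (j + 1)))
      (fun i _ => by positivity) (Finset.mem_univ j)
    unfold sobolevWeight at hk
    linarith
  have hb' := hb j
  rw [Real.lt_rpow_inv_iff_of_pos (abs_nonneg _) _ (by positivity)]
  · exact h1
  · exact (by positivity : (0 : ℝ) ≤ |2 * Real.pi * (k j : ℝ)| ^ (2 * b (j + 1))).trans h1.le

/-- A box containing all frequencies of weight less than `X`. -/
def frequencyBox (b : ℕ → ℝ) (d : ℕ) (X : ℝ) : Finset (Fin d → ℤ) :=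
  Fintype.piFinset fun j : Fin d =>
    Finset.Icc (-(⌊X ^ (2 * b (j + 1))⁻¹ / (2 * Real.pi)⌋₊ : ℤ))
      ⌊X ^ (2 * b (j + 1))⁻¹ / (2 * Real.pi)⌋₊

lemma mem_frequencyBox {b : ℕ → ℝ} {d : ℕ} (hb : ∀ j : ℕ, 0 < b (j + 1))
    {X : ℝ} {k : Fin d → ℤ} (hk : sobolevWeight b k < X) : k ∈ frequencyBox b d X := by
  rw [frequencyBox, Fintype.mem_piFinset]
  intro j
  have h := abs_lt_rpow_of_sobolevWeight_lt hb hk j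
  rw [abs_mul, abs_of_pos (by positivity : 0 < 2 * Real.pi), ← lt_div_iff₀' (by positivity)] at h
  have h2 : (k j).natAbs ≤ ⌊X ^ (2 * b (j + 1))⁻¹ / (2 * Real.pi)⌋₊ := by
    refine Nat.le_floor ?_
    rw [Nat.cast_natAbs, Int.cast_abs]
    exact h.le
  rw [Finset.mem_Icc]
  omega

/-- The frequencies of weight less than `X`. -/
def frequencies (b : ℕ → ℝ) (d : ℕ) (X : ℝ) : Finset (Fin d → ℤ) :=
  {k ∈ frequencyBox b d X | sobolevWeight b k < X}

lemma mem_frequencies {b : ℕ → ℝ} {d : ℕ} (hb : ∀ j : ℕ, 0 < b (j + 1))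
    {X : ℝ} {k : Fin d → ℤ} : k ∈ frequencies b d X ↔ sobolevWeight b k < X := by
  rw [frequencies, Finset.mem_filter, and_iff_right_iff_imp]
  exact mem_frequencyBox hb

lemma sobolevWeight_zero {b : ℕ → ℝ} (hb : ∀ j : ℕ, 0 < b (j + 1)) {d : ℕ} :
    sobolevWeight b (0 : Fin d → ℤ) = 1 := by
  rw [sobolevWeight, Finset.sum_eq_zero, add_zero]
  intro j _
  have := hb j
  simp only [Pi.zero_apply, Int.cast_zero, mul_zero, abs_zero]
  exact Real.zero_rpow (by positivity)

lemma minimalError_card_frequencies_le {b : ℕ → ℝ} (hb : ∀ j : ℕ, 0 < b (j + 1)) {d : ℕ} {ε : ℝ}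
    (hε : 0 < ε) : minimalError (frequencies b d (ε⁻¹ ^ 2)).card (sobolevEmbedding b d) ≤
      ENNReal.ofReal ε := by
  refine minimalError_card_le b _ hε fun k hk => ?_
  rwa [mem_frequencies hb, not_lt] at hk

/-- The information complexity counts the frequencies of weight less than `ε⁻²`. -/
lemma infoComplexity_sobolevEmbedding {b : ℕ → ℝ} (hb : ∀ j : ℕ, 0 < b (j + 1)) {d : ℕ} {ε : ℝ}
    (hε : 0 < ε) :
    infoComplexity ε (sobolevEmbedding b d) = (frequencies b d (ε⁻¹ ^ 2)).card := by
  have hmem := minimalError_card_frequencies_le hb (d := d) hε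
  refine le_antisymm (Nat.sInf_le hmem) (le_csInf ⟨_, hmem⟩ fun n hn => ?_)
  by_contra! hlt
  set B := frequencies b d (ε⁻¹ ^ 2) with hB
  have hne : B.Nonempty := Finset.card_pos.1 (by omega)
  -- The largest weight on the finite set `B` is strictly below `ε⁻²`, so the lower bound for the
  -- error strictly exceeds `ε`.
  obtain ⟨k₀, hk₀, hmax⟩ := B.exists_max_image (sobolevWeight b) hne
  have hk₁ := one_le_sobolevWeight b k₀
  have h := (le_minimalError b B hlt (by linarith) hmax).trans hn
  rw [ENNReal.ofReal_le_ofReal_iff hε.le,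
    inv_le_comm₀ (Real.sqrt_pos.2 (by linarith)) hε] at h
  have h2 := (mem_frequencies hb).1 hk₀
  have h3 := (Real.le_sqrt (by positivity) (by linarith)).1 h
  linarith

lemma one_le_card_frequencies {b : ℕ → ℝ} (hb : ∀ j : ℕ, 0 < b (j + 1)) {d : ℕ} {X : ℝ}
    (hX : 1 < X) : 1 ≤ (frequencies b d X).card :=
  Finset.card_pos.2 ⟨0, (mem_frequencies hb).2 (by rwa [sobolevWeight_zero hb])⟩

end Counting


/-! ### Box and 0-1 vector bounds for the count -/

section CountingBounds

/-- Upper bound for the number of frequencies by the volume of a box. -/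
lemma card_frequencies_le_rpow {b : ℕ → ℝ} (hb : ∀ j : ℕ, 0 < b (j + 1)) (d : ℕ) {u : ℝ}
    (hu : 1 ≤ u) :
    ((frequencies b d (u ^ 2)).card : ℝ) ≤ u ^ (∑ j ∈ Finset.range d, (b (j + 1))⁻¹) := by
  have h1 : (frequencies b d (u ^ 2)).card ≤ (frequencyBox b d (u ^ 2)).card :=
    Finset.card_le_card (Finset.filter_subset _ _)
  refine (Nat.cast_le.2 h1).trans ?_
  rw [frequencyBox, Fintype.card_piFinset, Real.rpow_sum_of_pos (by linarith),
    ← Fin.prod_univ_eq_prod_range (fun j => u ^ (b (j + 1))⁻¹), Nat.cast_prod]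
  refine Finset.prod_le_prod (fun _ _ => by positivity) fun j _ => ?_
  have hbj := hb j
  have ht : (u ^ 2) ^ (2 * b (j + 1))⁻¹ = u ^ (b (j + 1))⁻¹ := by
    rw [← Real.rpow_natCast, ← Real.rpow_mul (by linarith)]
    congr 1
    push_cast
    field_simp
  rw [ht]
  have h1t : 1 ≤ u ^ (b (j + 1))⁻¹ := Real.one_le_rpow hu (by positivity)
  set t := u ^ (b (j + 1))⁻¹
  have hM := Nat.floor_le (a := t / (2 * Real.pi)) (by positivity)
  set M := ⌊t / (2 * Real.pi)⌋₊
  have hcard : (Finset.Icc (-(M : ℤ)) M).card = 2 * M + 1 := by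
    rw [Int.card_Icc]
    omega
  rw [hcard]
  push_cast
  -- `2M + 1 ≤ t`: for `M = 0` this is `1 ≤ t`, otherwise `2M + 1 ≤ 3M ≤ 2πM ≤ t`. No factor per
  -- coordinate is lost, which makes the bound uniform in `d`.
  rcases Nat.eq_zero_or_pos M with h0 | h0
  · rw [h0]
    simpa using h1t
  · have h2 : (1 : ℝ) ≤ M := by exact_mod_cast h0
    rw [le_div_iff₀ (by positivity)] at hM
    nlinarith [Real.pi_gt_three]

/-- Lower bound for the number of frequencies by the volume of a box. -/
lemma exists_mul_rpow_le_card_frequencies {b : ℕ → ℝ} (hb : ∀ j : ℕ, 0 < b (j + 1)) {d : ℕ}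
    (hd : 1 ≤ d) : ∃ κ : ℝ, 0 < κ ∧ ∀ u : ℝ, 2 ≤ u →
      κ * u ^ (∑ j ∈ Finset.range d, (b (j + 1))⁻¹) ≤ (frequencies b d (u ^ 2)).card := by
  have hd0 : (0 : ℝ) < d := by exact_mod_cast hd
  -- Each coordinate may contribute `u²/(2d)`, so weights are at most `1 + u²/2`, which is below
  -- `u²` once `u ≥ 2`. Only nonnegative frequencies are counted.
  refine ⟨∏ j : Fin d, ((2 * d : ℝ)⁻¹ ^ (2 * b (j + 1))⁻¹ / (2 * Real.pi)),
    Finset.prod_pos fun j _ => by positivity, fun u hu => ?_⟩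
  set t : Fin d → ℝ := fun j => (u ^ 2 / (2 * d)) ^ (2 * b (j + 1))⁻¹ with ht
  have ht' : ∀ j : Fin d, t j = (2 * d : ℝ)⁻¹ ^ (2 * b (j + 1))⁻¹ * u ^ (b (j + 1))⁻¹ := by
    intro j
    have hbj := hb j
    rw [ht]
    simp only
    rw [div_eq_inv_mul, Real.mul_rpow (by positivity) (by positivity), ← Real.rpow_natCast u,
      ← Real.rpow_mul (by linarith)]
    congr 2
    push_cast
    field_simp
  let B : Finset (Fin d → ℤ) := Fintype.piFinset fun j : Fin d =>
    Finset.Icc (0 : ℤ) ⌊t j / (2 * Real.pi)⌋₊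
  have hB : B ⊆ frequencies b d (u ^ 2) := by
    intro k hk
    rw [Fintype.mem_piFinset] at hk
    rw [mem_frequencies hb, sobolevWeight]
    have h1 : ∀ j ∈ Finset.univ, |2 * Real.pi * (k j : ℝ)| ^ (2 * b ((j : Fin d) + 1)) ≤
        u ^ 2 / (2 * d) := by
      intro j _
      have hbj := hb j
      have hkj := Finset.mem_Icc.1 (hk j)
      have hk0 : (0 : ℝ) ≤ k j := by exact_mod_cast hkj.1
      have h2 : (k j : ℝ) ≤ t j / (2 * Real.pi) := by
        refine le_trans ?_ (Nat.floor_le (by positivity))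
        exact_mod_cast hkj.2
      rw [abs_of_nonneg (by positivity), ← Real.le_rpow_inv_iff_of_pos (by positivity)
        (by positivity) (by positivity)]
      rwa [le_div_iff₀' (by positivity)] at h2
    have h3 := Finset.sum_le_card_nsmul _ _ _ h1
    rw [Finset.card_univ, Fintype.card_fin, nsmul_eq_mul] at h3
    have h4 : (d : ℝ) * (u ^ 2 / (2 * d)) = u ^ 2 / 2 := by field_simp
    nlinarith
  refine le_trans ?_ (Nat.cast_le.2 (Finset.card_le_card hB))
  rw [Fintype.card_piFinset, Real.rpow_sum_of_pos (by linarith),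
    ← Fin.prod_univ_eq_prod_range (fun j => u ^ (b (j + 1))⁻¹), Nat.cast_prod,
    ← Finset.prod_mul_distrib]
  refine Finset.prod_le_prod (fun _ _ => by positivity) fun j _ => ?_
  rw [Int.card_Icc]
  have h5 := (Nat.lt_floor_add_one (t j / (2 * Real.pi))).le
  rw [ht'] at h5
  have h6 : ((⌊t j / (2 * Real.pi)⌋₊ : ℤ) + 1 - 0).toNat = ⌊t j / (2 * Real.pi)⌋₊ + 1 := by omega
  rw [h6]
  push_cast
  rw [ht']
  refine le_of_eq_of_le ?_ h5
  ring

/-- Counting the frequencies that are indicators of sets of at most `m` coordinates. -/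
lemma card_le_card_frequencies {b : ℕ → ℝ} (hb : ∀ j : ℕ, 0 < b (j + 1))
    (hb_mono : ∀ i j : ℕ, 1 ≤ i → i ≤ j → b i ≤ b j) {d m : ℕ} {X : ℝ}
    (F : Finset (Finset (Fin d))) (hF : ∀ s ∈ F, s.card ≤ m)
    (hX : 1 + m * (2 * Real.pi) ^ (2 * b d) < X) :
    F.card ≤ (frequencies b d X).card := by
  have h2π : 1 ≤ 2 * Real.pi := by linarith [Real.pi_gt_three]
  refine Finset.card_le_card_of_injOn (fun s j => if j ∈ s then (1 : ℤ) else 0) ?_ ?_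
  · intro s hs
    rw [Finset.mem_coe, mem_frequencies hb, sobolevWeight]
    refine lt_of_le_of_lt (add_le_add_right ?_ 1) hX
    have h1 : ∀ j : Fin d, |2 * Real.pi * (((if j ∈ s then 1 else 0 : ℤ)) : ℝ)| ^ (2 * b (j + 1)) ≤
        if j ∈ s then (2 * Real.pi) ^ (2 * b d) else 0 := by
      intro j
      have hbj := hb j
      split_ifs with h
      · rw [Int.cast_one, mul_one, abs_of_pos (by positivity)]
        refine Real.rpow_le_rpow_of_exponent_le h2π ?_
        have := hb_mono (j + 1) d (by omega) j.2
        linarith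
      · rw [Int.cast_zero, mul_zero, abs_zero, Real.zero_rpow (by positivity)]
    refine (Finset.sum_le_sum fun j _ => h1 j).trans ?_
    rw [Finset.sum_ite_mem, Finset.univ_inter, Finset.sum_const, nsmul_eq_mul]
    exact mul_le_mul_of_nonneg_right (Nat.cast_le.2 (hF s hs)) (by positivity)
  · intro s _ s' _ h
    ext j
    have := congrFun h j
    by_cases h1 : j ∈ s <;> by_cases h2 : j ∈ s' <;> simp_all

lemma two_pow_le_card_frequencies {b : ℕ → ℝ} (hb : ∀ j : ℕ, 0 < b (j + 1))
    (hb_mono : ∀ i j : ℕ, 1 ≤ i → i ≤ j → b i ≤ b j) {d : ℕ} {X : ℝ}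
    (hX : 1 + d * (2 * Real.pi) ^ (2 * b d) < X) :
    2 ^ d ≤ (frequencies b d X).card := by
  have h := card_le_card_frequencies hb hb_mono (Finset.univ : Finset (Finset (Fin d)))
    (fun s _ => (Finset.card_le_univ s).trans_eq (Fintype.card_fin d)) hX
  simpa using h

lemma choose_le_card_frequencies {b : ℕ → ℝ} (hb : ∀ j : ℕ, 0 < b (j + 1))
    (hb_mono : ∀ i j : ℕ, 1 ≤ i → i ≤ j → b i ≤ b j) {d m : ℕ} {X : ℝ}
    (hX : 1 + m * (2 * Real.pi) ^ (2 * b d) < X) :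
    d.choose m ≤ (frequencies b d X).card := by
  have h := card_le_card_frequencies hb hb_mono
    (Finset.powersetCard m (Finset.univ : Finset (Fin d)))
    (fun s hs => (Finset.mem_powersetCard.1 hs).2.le) hX
  simpa using h

end CountingBounds

/-! ### The Chernoff bound for the count -/

section Laplace

/-- Raise `x ≤ exp x`, at `x = v / (2A)`, to the power `A`. -/
lemma exp_neg_half_le_rpow {A v : ℝ} (hA : 0 < A) (hv : 0 < v) :
    Real.exp (-v / 2) ≤ (2 * A) ^ A * v ^ (-A) := by
  have h1 : v / (2 * A) ≤ Real.exp (v / (2 * A)) := by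
    linarith [Real.add_one_le_exp (v / (2 * A))]
  have h2 := Real.rpow_le_rpow (by positivity) h1 hA.le
  rw [← Real.exp_mul, Real.div_rpow hv.le (by positivity)] at h2
  have h3 : v / (2 * A) * A = v / 2 := by field_simp
  rw [h3, div_le_iff₀ (by positivity)] at h2
  rw [neg_div, Real.exp_neg, Real.rpow_neg hv.le, inv_le_iff_one_le_mul₀ (Real.exp_pos _)]
  have h4 : 0 < v ^ A := by positivity
  calc 1 = v ^ A * (v ^ A)⁻¹ := (mul_inv_cancel₀ h4.ne').symm
    _ ≤ Real.exp (v / 2) * (2 * A) ^ A * (v ^ A)⁻¹ := by gcongr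
    _ = _ := by ring

/-- Bound for the one-dimensional theta-type sums `∑ₖ exp (-λ|2πk|^{2r})`, uniform in `r ≥ β`. -/
lemma exists_sum_exp_le {β : ℝ} (hβ : 0 < β) : ∃ C : ℝ, 0 < C ∧ ∀ r l : ℝ, β ≤ r → 0 < l →
    ∀ M : ℕ, ∑ k ∈ Finset.Icc (-(M : ℤ)) M, Real.exp (-l * |2 * Real.pi * (k : ℝ)| ^ (2 * r)) ≤
      1 + C * (l * (2 * Real.pi) ^ (2 * r)) ^ (-β⁻¹) *
        Real.exp (-(l * (2 * Real.pi) ^ (2 * r)) / 2) := by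
  have hsum : Summable fun k : ℤ => 1 / (k : ℝ) ^ 2 := Real.summable_one_div_int_pow.2 one_lt_two
  set K : ℝ := (2 * β⁻¹) ^ β⁻¹ with hK
  have hKpos : 0 < K := by positivity
  set S : ℝ := ∑' k : ℤ, 1 / (k : ℝ) ^ 2 with hS
  have hSpos : 0 < S := hsum.tsum_pos (fun k => by positivity) 1 (by norm_num)
  refine ⟨K * S, by positivity, fun r l hr hl M => ?_⟩
  have hr0 : 0 < r := hβ.trans_le hr
  set y := l * (2 * Real.pi) ^ (2 * r) with hy
  have hy0 : 0 < y := by positivity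
  have hterm : ∀ k : ℤ, Real.exp (-l * |2 * Real.pi * (k : ℝ)| ^ (2 * r)) ≤
      (if k = 0 then 1 else 0) + K * y ^ (-β⁻¹) * Real.exp (-y / 2) * (1 / (k : ℝ) ^ 2) := by
    intro k
    split_ifs with hk
    · rw [hk, Int.cast_zero, mul_zero, abs_zero, Real.zero_rpow (by positivity)]
      simp
    · have hk1 : (1 : ℝ) ≤ |(k : ℝ)| := by exact_mod_cast Int.one_le_abs hk
      have h1 : |2 * Real.pi * (k : ℝ)| ^ (2 * r) = (2 * Real.pi) ^ (2 * r) * |(k : ℝ)| ^ (2 * r) := by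
        rw [abs_mul, abs_of_pos (by positivity : 0 < 2 * Real.pi),
          Real.mul_rpow (by positivity) (by positivity)]
      have h2 : |(k : ℝ)| ^ (2 * β) ≤ |(k : ℝ)| ^ (2 * r) :=
        Real.rpow_le_rpow_of_exponent_le hk1 (by linarith)
      have h3 : 1 ≤ |(k : ℝ)| ^ (2 * β) := Real.one_le_rpow hk1 (by positivity)
      -- The exponent is split: one half yields `exp (-y/2)`, the other, by the power bound with
      -- exponent `-1/β`, yields `(|k|^(2β))^(-1/β) = |k|⁻²`, summable with a bound independent of
      -- `r`.
      have h4 : -l * |2 * Real.pi * (k : ℝ)| ^ (2 * r) ≤ -y / 2 + -(y * |(k : ℝ)| ^ (2 * β)) / 2 := by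
        rw [h1, neg_mul, ← mul_assoc, ← hy]
        nlinarith
      rw [zero_add]
      calc _ ≤ Real.exp (-y / 2) * Real.exp (-(y * |(k : ℝ)| ^ (2 * β)) / 2) := by
            rw [← Real.exp_add]
            exact Real.exp_le_exp.2 h4
        _ ≤ Real.exp (-y / 2) * (K * (y * |(k : ℝ)| ^ (2 * β)) ^ (-β⁻¹)) := by
            gcongr
            exact exp_neg_half_le_rpow (by positivity) (by positivity)
        _ = _ := by
            have h5 : (y * |(k : ℝ)| ^ (2 * β)) ^ (-β⁻¹) = y ^ (-β⁻¹) * (1 / (k : ℝ) ^ 2) := by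
              rw [Real.mul_rpow hy0.le (by positivity), ← Real.rpow_mul (abs_nonneg _)]
              have h6 : 2 * β * -β⁻¹ = -(2 : ℕ) := by
                push_cast
                field_simp
              rw [h6, Real.rpow_neg (abs_nonneg _), Real.rpow_natCast, sq_abs, one_div]
            rw [h5]
            ring
  refine (Finset.sum_le_sum fun k _ => hterm k).trans ?_
  rw [Finset.sum_add_distrib, ← Finset.mul_sum]
  refine add_le_add ?_ ?_
  · rw [Finset.sum_ite_eq']
    split_ifs <;> norm_num
  · have h7 : ∑ k ∈ Finset.Icc (-(M : ℤ)) M, 1 / (k : ℝ) ^ 2 ≤ S :=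
      hsum.sum_le_tsum _ fun k _ => by positivity
    calc _ ≤ K * y ^ (-β⁻¹) * Real.exp (-y / 2) * S := by gcongr
      _ = _ := by ring

/-- The logarithm of the bound for a one-dimensional sum. -/
def laplaceTerm (C A y : ℝ) : ℝ := Real.log (1 + C * y ^ (-A) * Real.exp (-y / 2))

lemma laplaceTerm_nonneg {C A y : ℝ} (hC : 0 < C) (hy : 0 < y) : 0 ≤ laplaceTerm C A y :=
  Real.log_nonneg (by have : 0 < C * y ^ (-A) * Real.exp (-y / 2) := by positivity
                      linarith)

lemma laplaceTerm_le {C A y : ℝ} (hC : 0 < C) (hy : 0 < y) :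
    laplaceTerm C A y ≤ C * y ^ (-A) * Real.exp (-y / 2) := by
  have : 0 < C * y ^ (-A) * Real.exp (-y / 2) := by positivity
  have h := Real.log_le_sub_one_of_pos (x := 1 + C * y ^ (-A) * Real.exp (-y / 2)) (by linarith)
  unfold laplaceTerm
  linarith

/-- `θ log (1 + v) = log ((1 + v)^θ) ≤ (1 + v)^θ - 1 ≤ v^θ`, the last step by subadditivity of the
power. -/
lemma log_one_add_le_rpow_div {v θ : ℝ} (hv : 0 ≤ v) (h0 : 0 < θ) (h1 : θ ≤ 1) :
    Real.log (1 + v) ≤ v ^ θ / θ := by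
  rw [le_div_iff₀ h0, mul_comm, ← Real.log_rpow (by linarith)]
  have h2 := Real.rpow_add_le_add_rpow zero_le_one hv h0.le h1
  rw [Real.one_rpow] at h2
  have h3 := Real.log_le_sub_one_of_pos (x := (1 + v) ^ θ) (by positivity)
  linarith

/-- For `a ≤ A` the logarithm flattens the singularity `y^(-A)` to `y^(-a)`; for `a > A` the
exponential supplies the missing decay. The freedom in `a` drives the sufficiency proofs. -/
lemma exists_laplaceTerm_le_rpow {C A : ℝ} (hC : 0 < C) (hA : 0 < A) {a : ℝ} (ha : 0 < a) :
    ∃ D : ℝ, 0 < D ∧ ∀ y : ℝ, 0 < y → laplaceTerm C A y ≤ D * y ^ (-a) := by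
  rcases le_or_gt a A with h | h
  · refine ⟨C ^ (a / A) / (a / A), by positivity, fun y hy => ?_⟩
    have h1 : C * y ^ (-A) * Real.exp (-y / 2) ≤ C * y ^ (-A) :=
      mul_le_of_le_one_right (by positivity) (Real.exp_le_one_iff.2 (by linarith))
    have h2 : (C * y ^ (-A)) ^ (a / A) = C ^ (a / A) * y ^ (-a) := by
      rw [Real.mul_rpow hC.le (by positivity), ← Real.rpow_mul hy.le]
      congr 2
      field_simp
    calc laplaceTerm C A y ≤ Real.log (1 + C * y ^ (-A)) :=
          Real.log_le_log (by positivity) (by linarith)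
      _ ≤ (C * y ^ (-A)) ^ (a / A) / (a / A) :=
          log_one_add_le_rpow_div (by positivity) (by positivity) ((div_le_one hA).2 h)
      _ = _ := by
          rw [h2]
          ring
  · have h' : 0 < a - A := sub_pos.2 h
    refine ⟨C * (2 * (a - A)) ^ (a - A), by positivity, fun y hy => ?_⟩
    calc laplaceTerm C A y ≤ C * y ^ (-A) * Real.exp (-y / 2) := laplaceTerm_le hC hy
      _ ≤ C * y ^ (-A) * ((2 * (a - A)) ^ (a - A) * y ^ (-(a - A))) := by
          gcongr
          exact exp_neg_half_le_rpow h' hy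
      _ = C * (2 * (a - A)) ^ (a - A) * (y ^ (-A) * y ^ (-(a - A))) := by ring
      _ = _ := by
          rw [← Real.rpow_add hy]
          congr 2
          ring

/-- The Laplace (Chernoff) bound for the number of frequencies of weight less than `X`. -/
lemma exists_log_card_frequencies_le {b : ℕ → ℝ} {β : ℝ} (hβ : 0 < β)
    (hb : ∀ j : ℕ, β ≤ b (j + 1)) : ∃ C A : ℝ, 0 < C ∧ 0 < A ∧ ∀ (d : ℕ) (X l : ℝ), 1 < X → 0 < l →
      Real.log (frequencies b d X).card ≤ l * X +
        ∑ j ∈ Finset.range d, laplaceTerm C A (l * (2 * Real.pi) ^ (2 * b (j + 1))) := by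
  obtain ⟨C, hC, hCsum⟩ := exists_sum_exp_le hβ
  have hb0 : ∀ j : ℕ, 0 < b (j + 1) := fun j => hβ.trans_le (hb j)
  refine ⟨C, β⁻¹, hC, by positivity, fun d X l hX hl => ?_⟩
  have hN : 0 < ((frequencies b d X).card : ℝ) :=
    Nat.cast_pos.2 (one_le_card_frequencies hb0 hX)
  set P : ℝ := ∏ j ∈ Finset.range d, (1 + C * (l * (2 * Real.pi) ^ (2 * b (j + 1))) ^ (-β⁻¹) *
        Real.exp (-(l * (2 * Real.pi) ^ (2 * b (j + 1))) / 2)) with hP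
  -- Each counted frequency has `∑ⱼ |2πkⱼ|^(2bⱼ) < X`, so `exp (-lX)` is at most a product over
  -- coordinates. Enlarging the sum to the whole box then factorises it.
  have h1 : ((frequencies b d X).card : ℝ) * Real.exp (-(l * X)) ≤ P := by
    calc ((frequencies b d X).card : ℝ) * Real.exp (-(l * X))
        = ∑ k ∈ frequencies b d X, Real.exp (-(l * X)) := by
          rw [Finset.sum_const, nsmul_eq_mul]
      _ ≤ ∑ k ∈ frequencies b d X,
            ∏ j : Fin d, Real.exp (-l * |2 * Real.pi * (k j : ℝ)| ^ (2 * b (j + 1))) := by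
          refine Finset.sum_le_sum fun k hk => ?_
          rw [← Real.exp_sum, ← Finset.mul_sum]
          have h2 := (mem_frequencies hb0).1 hk
          rw [sobolevWeight] at h2
          refine Real.exp_le_exp.2 ?_
          nlinarith
      _ ≤ ∑ k ∈ frequencyBox b d X,
            ∏ j : Fin d, Real.exp (-l * |2 * Real.pi * (k j : ℝ)| ^ (2 * b (j + 1))) :=
          Finset.sum_le_sum_of_subset_of_nonneg (Finset.filter_subset _ _)
            fun k _ _ => by positivity
      _ = ∏ j : Fin d, ∑ k ∈ Finset.Icc (-(⌊X ^ (2 * b (j + 1))⁻¹ / (2 * Real.pi)⌋₊ : ℤ))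
            ⌊X ^ (2 * b (j + 1))⁻¹ / (2 * Real.pi)⌋₊,
            Real.exp (-l * |2 * Real.pi * (k : ℝ)| ^ (2 * b (j + 1))) := by
          rw [Finset.prod_univ_sum]
          rfl
      _ ≤ P := by
          rw [hP, ← Fin.prod_univ_eq_prod_range (fun j =>
            (1 + C * (l * (2 * Real.pi) ^ (2 * b (j + 1))) ^ (-β⁻¹) *
            Real.exp (-(l * (2 * Real.pi) ^ (2 * b (j + 1))) / 2)))]
          exact Finset.prod_le_prod (fun _ _ => by positivity) fun j _ => hCsum _ l (hb j) hl _
  have h3 : Real.log P = ∑ j ∈ Finset.range d,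
      laplaceTerm C β⁻¹ (l * (2 * Real.pi) ^ (2 * b (j + 1))) := by
    rw [hP, Real.log_prod]
    · rfl
    · intro j _
      positivity
  rw [← h3]
  have h4 := Real.log_le_log (by positivity) h1
  rw [Real.log_mul hN.ne' (Real.exp_pos _).ne', Real.log_exp] at h4
  linarith

end Laplace


/-! ### Weak tractability as bounds on the logarithm -/

section TractFilter

lemma eventually_tractFilter {P : ℝ × ℕ → Prop} :
    (∀ᶠ p in tractFilter, P p) ↔ ∃ R : ℝ, ∀ (ε : ℝ) (d : ℕ), 0 < ε → ε < 1 → 1 ≤ d →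
      R ≤ ε⁻¹ + d → P (ε, d) := by
  rw [tractFilter, eventually_inf_principal, eventually_comap, eventually_atTop]
  constructor
  · rintro ⟨R, hR⟩
    exact ⟨R, fun ε d h0 h1 hd h => hR _ h (ε, d) rfl ⟨h0, h1, hd⟩⟩
  · rintro ⟨R, hR⟩
    refine ⟨R, ?_⟩
    rintro x hx ⟨ε, d⟩ rfl ⟨h0, h1, hd⟩
    exact hR ε d h0 h1 hd hx

lemma tendsto_add_rpow_tractFilter {s t : ℝ} (hs : 0 < s) (ht : 0 < t) :
    Tendsto (fun p : ℝ × ℕ => p.1⁻¹ ^ s + (p.2 : ℝ) ^ t) tractFilter atTop := by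
  rw [tendsto_atTop]
  intro T
  have h1 := (tendsto_rpow_atTop hs).eventually_ge_atTop T
  have h2 := (tendsto_rpow_atTop ht).eventually_ge_atTop T
  obtain ⟨R, hR⟩ := eventually_atTop.1 (h1.and h2)
  refine eventually_tractFilter.2 ⟨2 * R, fun ε d h0 _ _ h => ?_⟩
  have hε : 0 < ε⁻¹ := inv_pos.2 h0
  have p1 : 0 ≤ ε⁻¹ ^ s := by positivity
  have p2 : 0 ≤ (d : ℝ) ^ t := by positivity
  rcases le_total R ε⁻¹ with h3 | h3
  · have := (hR _ h3).1
    simp only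
    linarith
  · have := (hR d (by linarith)).2
    simp only
    linarith

variable {H G : ℕ → Type*} [∀ d, NormedAddCommGroup (H d)] [∀ d, NormedSpace ℂ (H d)]
  [∀ d, NormedAddCommGroup (G d)] [∀ d, NormedSpace ℂ (G d)]

/-- The additive constant is harmless because `ε⁻ˢ + dᵗ → ∞` along the filter. -/
lemma isWTst_of_log_le {S : ∀ d, H d →L[ℂ] G d} {s t : ℝ} (hs : 0 < s) (ht : 0 < t)
    (h : ∀ η : ℝ, 0 < η → ∃ C : ℝ, ∀ (ε : ℝ) (d : ℕ), 0 < ε → ε < 1 → 1 ≤ d →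
      Real.log (infoComplexity ε (S d)) ≤ η * (ε⁻¹ ^ s + (d : ℝ) ^ t) + C) :
    IsWTst s t S := by
  rw [IsWTst, Metric.tendsto_nhds]
  intro η hη
  obtain ⟨C, hC⟩ := h (η / 2) (by positivity)
  obtain ⟨R, hR⟩ := eventually_tractFilter.1
    ((tendsto_add_rpow_tractFilter hs ht).eventually_gt_atTop (2 * |C| / η))
  refine eventually_tractFilter.2 ⟨R, fun ε d h0 h1 hd hRd => ?_⟩
  have h2 := hR ε d h0 h1 hd hRd
  have h3 := hC ε d h0 h1 hd
  simp only at h2 ⊢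
  set D := ε⁻¹ ^ s + (d : ℝ) ^ t
  have hD : 0 < D := lt_of_le_of_lt (by positivity) h2
  rw [div_lt_iff₀ hη] at h2
  rw [Real.dist_eq, sub_zero, abs_of_nonneg (div_nonneg (Real.log_natCast_nonneg _) hD.le),
    div_lt_iff₀ hD]
  have := le_abs_self C
  linarith

lemma IsWTst.exists_log_le {S : ∀ d, H d →L[ℂ] G d} {s t : ℝ} (h : IsWTst s t S) {η : ℝ}
    (hη : 0 < η) : ∃ R : ℝ, ∀ (ε : ℝ) (d : ℕ), 0 < ε → ε < 1 → 1 ≤ d → R ≤ ε⁻¹ + d →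
      Real.log (infoComplexity ε (S d)) ≤ η * (ε⁻¹ ^ s + (d : ℝ) ^ t) := by
  obtain ⟨R, hR⟩ := eventually_tractFilter.1 (h.eventually_lt_const hη)
  refine ⟨R, fun ε d h0 h1 hd hRd => ?_⟩
  have h2 := hR ε d h0 h1 hd hRd
  have hε : 0 < ε⁻¹ := inv_pos.2 h0
  have hD : 0 < ε⁻¹ ^ s + (d : ℝ) ^ t := by positivity
  exact ((div_lt_iff₀ hD).1 h2).le

lemma isWT_iff_isWTst {S : ∀ d, H d →L[ℂ] G d} : IsWT S ↔ IsWTst 1 1 S := by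
  simp only [IsWT, IsWTst, Real.rpow_one]

lemma IsSPT.isPT {S : ∀ d, H d →L[ℂ] G d} (h : IsSPT S) : IsPT S := by
  obtain ⟨C, p, hC, hp, h⟩ := h
  exact ⟨C, p, 0, hC, hp, le_rfl, by simpa using h⟩

end TractFilter

/-! ### Weak tractability in terms of the count -/

section SobolevTract

lemma isWTst_sobolevEmbedding_of_log_le {b : ℕ → ℝ} (hb : ∀ j : ℕ, 0 < b (j + 1)) {s t : ℝ}
    (hs : 0 < s) (ht : 0 < t)
    (h : ∀ η : ℝ, 0 < η → ∃ C : ℝ, ∀ (u : ℝ) (d : ℕ), 1 < u → 1 ≤ d →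
      Real.log (frequencies b d (u ^ 2)).card ≤ η * (u ^ s + (d : ℝ) ^ t) + C) :
    IsWTst s t (sobolevEmbedding b) := by
  refine isWTst_of_log_le hs ht fun η hη => ?_
  obtain ⟨C, hC⟩ := h η hη
  refine ⟨C, fun ε d h0 h1 hd => ?_⟩
  rw [infoComplexity_sobolevEmbedding hb h0]
  exact hC ε⁻¹ d ((one_lt_inv₀ h0).2 h1) hd

/-- Large `d` alone makes `ε⁻¹ + d` large, so the estimate holds for all `X = ε⁻²` at once. Later
`X` is chosen depending on `d`. -/
lemma IsWTst.exists_log_card_frequencies_le {b : ℕ → ℝ} (hb : ∀ j : ℕ, 0 < b (j + 1)) {s t : ℝ}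
    (h : IsWTst s t (sobolevEmbedding b)) {η : ℝ} (hη : 0 < η) :
    ∀ᶠ d : ℕ in atTop, ∀ X : ℝ, 1 < X →
      Real.log (frequencies b d X).card ≤ η * (X ^ (s / 2) + (d : ℝ) ^ t) := by
  obtain ⟨R, hR⟩ := h.exists_log_le hη
  filter_upwards [eventually_ge_atTop 1, tendsto_natCast_atTop_atTop.eventually_ge_atTop R]
    with d hd hRd X hX
  have h1 : 1 < √X := by rwa [Real.lt_sqrt zero_le_one, one_pow]
  have h0 : 0 < √X := by linarith
  have h2 := hR (√X)⁻¹ d (inv_pos.2 h0) (inv_lt_one_of_one_lt₀ h1) hd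
    (by rw [inv_inv]; linarith)
  rw [infoComplexity_sobolevEmbedding hb (inv_pos.2 h0), inv_inv, Real.sq_sqrt (by linarith),
    Real.sqrt_eq_rpow, ← Real.rpow_mul (by linarith), one_div_mul_eq_div] at h2
  exact h2

end SobolevTract

/-! ### Elementary growth and summation estimates -/

section Growth

lemma exists_rpow_le_mul_add {θ η : ℝ} (hθ0 : 0 ≤ θ) (hθ : θ < 1) (hη : 0 < η) :
    ∃ C : ℝ, 0 ≤ C ∧ ∀ M : ℝ, 0 ≤ M → M ^ θ ≤ η * M + C := by
  obtain ⟨R, hR⟩ := eventually_atTop.1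
    ((tendsto_rpow_atTop (sub_pos.2 hθ)).eventually_ge_atTop η⁻¹)
  set R' := max R 1
  have hR' : 1 ≤ R' := le_max_right _ _
  refine ⟨R' ^ θ, by positivity, fun M hM => ?_⟩
  rcases le_total M R' with h1 | h1
  · have := Real.rpow_le_rpow hM h1 hθ0
    have : 0 ≤ η * M := by positivity
    linarith
  · have hM0 : 0 < M := by linarith
    have h2 := hR M ((le_max_left _ _).trans h1)
    rw [Real.rpow_sub hM0, Real.rpow_one, le_div_iff₀ (by positivity),
      inv_mul_le_iff₀ hη] at h2
    have : 0 ≤ R' ^ θ := by positivity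
    linarith

/-- A weak form of Young's inequality. -/
lemma exists_rpow_mul_rpow_le {s t p q η : ℝ} (hs : 0 < s) (ht : 0 < t) (hp : 0 ≤ p) (hq : 0 ≤ q)
    (hpq : p / s + q / t < 1) (hη : 0 < η) :
    ∃ C : ℝ, 0 ≤ C ∧ ∀ u v : ℝ, 1 ≤ u → 1 ≤ v → u ^ p * v ^ q ≤ η * (u ^ s + v ^ t) + C := by
  obtain ⟨C, hC0, hC⟩ := exists_rpow_le_mul_add (by positivity) hpq hη
  refine ⟨C, hC0, fun u v hu hv => ?_⟩
  have hu' : 0 < u ^ s := by positivity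
  have hv' : 0 < v ^ t := by positivity
  -- Both factors are bounded by powers of the single quantity `u^s + v^t`, with exponents adding up
  -- to less than 1.
  have h1 : u ^ p ≤ (u ^ s + v ^ t) ^ (p / s) := by
    calc u ^ p = (u ^ s) ^ (p / s) := by
          rw [← Real.rpow_mul (by linarith)]
          congr 1
          field_simp
      _ ≤ _ := Real.rpow_le_rpow hu'.le (by linarith) (by positivity)
  have h2 : v ^ q ≤ (u ^ s + v ^ t) ^ (q / t) := by
    calc v ^ q = (v ^ t) ^ (q / t) := by
          rw [← Real.rpow_mul (by linarith)]
          congr 1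
          field_simp
      _ ≤ _ := Real.rpow_le_rpow hv'.le (by linarith) (by positivity)
  calc u ^ p * v ^ q ≤ (u ^ s + v ^ t) ^ (p / s) * (u ^ s + v ^ t) ^ (q / t) := by gcongr
    _ = (u ^ s + v ^ t) ^ (p / s + q / t) := (Real.rpow_add (by positivity) _ _).symm
    _ ≤ _ := hC _ (by positivity)

/-- Only exponents matter as `u → ∞`; this discards constants depending on `d`. -/
lemma le_of_mul_rpow_le {κ D B p : ℝ} (hκ : 0 < κ)
    (h : ∀ u : ℝ, 2 ≤ u → κ * u ^ B ≤ D * u ^ p) : B ≤ p := by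
  by_contra! hlt
  have h1 := (tendsto_rpow_atTop (sub_pos.2 hlt)).eventually_gt_atTop (D / κ)
  obtain ⟨u, hu, hu2⟩ := (h1.and (eventually_ge_atTop 2)).exists
  have h2 := h u hu2
  have hu0 : 0 < u := by linarith
  rw [div_lt_iff₀ hκ, Real.rpow_sub hu0, div_mul_eq_mul_div, lt_div_iff₀ (by positivity)] at hu
  linarith

lemma exists_sum_range_le_of_tendsto_zero {f : ℕ → ℝ} (hf : Tendsto f atTop (𝓝 0)) {η : ℝ}
    (hη : 0 < η) : ∃ C : ℝ, ∀ d : ℕ, ∑ j ∈ Finset.range d, f j ≤ η * d + C := by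
  obtain ⟨J, hJ⟩ := eventually_atTop.1 (hf.eventually_lt_const hη)
  refine ⟨∑ j ∈ Finset.range J, |f j|, fun d => ?_⟩
  have h1 : ∀ j ∈ Finset.range d, f j ≤ η + if j ∈ Finset.range J then |f j| else 0 := by
    intro j _
    split_ifs with h
    · linarith [le_abs_self (f j)]
    · linarith [hJ j (by simpa using h)]
  refine (Finset.sum_le_sum h1).trans ?_
  rw [Finset.sum_add_distrib, Finset.sum_const, Finset.card_range, nsmul_eq_mul, mul_comm,
    Finset.sum_ite_mem]
  gcongr
  exact Finset.inter_subset_right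

/-- Telescoping: `1/√(j+1) ≤ 2(√(j+1) - √j)`. -/
lemma sum_one_div_sqrt_le (m : ℕ) :
    ∑ j ∈ Finset.range m, 1 / √((j : ℝ) + 1) ≤ 2 * √(m : ℝ) := by
  induction m with
  | zero => simp
  | succ m ih =>
    rw [Finset.sum_range_succ]
    push_cast
    have h1 : 0 < √((m : ℝ) + 1) := by positivity
    have h2 := Real.sq_sqrt (by positivity : 0 ≤ (m : ℝ) + 1)
    have h3 := Real.sq_sqrt (by positivity : 0 ≤ (m : ℝ))
    have h4 : 1 / √((m : ℝ) + 1) ≤ 2 * √((m : ℝ) + 1) - 2 * √(m : ℝ) := by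
      rw [div_le_iff₀ h1]
      nlinarith [sq_nonneg (√((m : ℝ) + 1) - √(m : ℝ))]
    linarith

/-- Summation of `min (√z, z²)` along `z = Q / (j + 1)`. -/
lemma sum_min_sqrt_sq_le {Q : ℝ} (hQ : 0 < Q) (d : ℕ) :
    ∑ j ∈ Finset.range d, min √(Q / ((j : ℝ) + 1)) ((Q / ((j : ℝ) + 1)) ^ 2) ≤ 4 * Q := by
  -- The cut is at `j ≈ Q`: the square root is used before it, the square after it, and each part
  -- costs at most `2Q`.
  set m := ⌊Q⌋₊
  have hm : (m : ℝ) ≤ Q := Nat.floor_le hQ.le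
  have hm' : Q < m + 1 := Nat.lt_floor_add_one Q
  have h1 : ∀ j ∈ Finset.range d, min √(Q / ((j : ℝ) + 1)) ((Q / ((j : ℝ) + 1)) ^ 2) ≤
      (if j ∈ Finset.range m then √Q * (1 / √((j : ℝ) + 1)) else 0) +
      if j ∈ Finset.Ico m d then Q ^ 2 * (((j + 1 : ℕ) : ℝ) ^ 2)⁻¹ else 0 := by
    intro j hj
    rw [Finset.mem_range] at hj
    by_cases h : j < m
    · rw [if_pos (Finset.mem_range.2 h), if_neg (by rw [Finset.mem_Ico]; omega), add_zero]
      refine (min_le_left _ _).trans_eq ?_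
      rw [Real.sqrt_div hQ.le, mul_one_div]
    · rw [if_neg (by rwa [Finset.mem_range]), if_pos (by rw [Finset.mem_Ico]; omega), zero_add]
      refine (min_le_right _ _).trans_eq ?_
      rw [div_pow]
      push_cast
      rfl
  refine (Finset.sum_le_sum h1).trans ?_
  rw [Finset.sum_add_distrib, Finset.sum_ite_mem, Finset.sum_ite_mem]
  have h2 : ∑ j ∈ Finset.range d ∩ Finset.range m, √Q * (1 / √((j : ℝ) + 1)) ≤ 2 * Q := by
    calc _ ≤ ∑ j ∈ Finset.range m, √Q * (1 / √((j : ℝ) + 1)) :=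
          Finset.sum_le_sum_of_subset_of_nonneg Finset.inter_subset_right
            fun _ _ _ => by positivity
      _ = √Q * ∑ j ∈ Finset.range m, 1 / √((j : ℝ) + 1) := by rw [Finset.mul_sum]
      _ ≤ √Q * (2 * √(m : ℝ)) := by
          gcongr
          exact sum_one_div_sqrt_le m
      _ ≤ √Q * (2 * √Q) := by gcongr
      _ = 2 * Q := by rw [mul_left_comm, Real.mul_self_sqrt hQ.le]
  have h3 : ∑ j ∈ Finset.range d ∩ Finset.Ico m d, Q ^ 2 * (((j + 1 : ℕ) : ℝ) ^ 2)⁻¹ ≤ 2 * Q := by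
    calc _ ≤ ∑ j ∈ Finset.Ico m d, Q ^ 2 * (((j + 1 : ℕ) : ℝ) ^ 2)⁻¹ :=
          Finset.sum_le_sum_of_subset_of_nonneg Finset.inter_subset_right
            fun _ _ _ => by positivity
      _ = Q ^ 2 * ∑ i ∈ Finset.Ioo m (d + 1), ((i : ℝ) ^ 2)⁻¹ := by
          rw [← Finset.mul_sum, Finset.sum_Ico_add' (fun i : ℕ => ((i : ℝ) ^ 2)⁻¹)]
          congr 2
      _ ≤ Q ^ 2 * (2 / (m + 1)) := by
          gcongr
          exact sum_Ioo_inv_sq_le m (d + 1)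
      _ ≤ Q ^ 2 * (2 / Q) := by gcongr
      _ = 2 * Q := by field_simp
  linarith

end Growth


/-! ### Sufficient conditions through the choice of `l` -/

section Sufficiency

lemma one_lt_two_pi : 1 < 2 * Real.pi := by linarith [Real.pi_gt_three]

lemma one_le_two_pi_rpow {r : ℝ} (hr : 0 < r) : 1 ≤ (2 * Real.pi) ^ (2 * r) :=
  Real.one_le_rpow one_lt_two_pi.le (by positivity)

lemma exists_laplaceTerm_mul_le {C A a : ℝ} (hC : 0 < C) (hA : 0 < A) (ha : 0 < a) :
    ∃ D : ℝ, 0 < D ∧ ∀ l c : ℝ, 0 < l → 1 ≤ c → laplaceTerm C A (l * c) ≤ D * l ^ (-a) := by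
  obtain ⟨D, hD, h⟩ := exists_laplaceTerm_le_rpow hC hA ha
  refine ⟨D, hD, fun l c hl hc => (h _ (by positivity)).trans ?_⟩
  refine mul_le_mul_of_nonneg_left ?_ hD.le
  exact Real.rpow_le_rpow_of_nonpos hl (le_mul_of_one_le_right hl.le hc) (by linarith)

lemma inv_sq_rpow_neg {u : ℝ} (hu : 0 < u) (a : ℝ) : ((u ^ 2)⁻¹) ^ (-a) = u ^ (2 * a) := by
  rw [Real.inv_rpow (by positivity), Real.rpow_neg (by positivity), inv_inv, ← Real.rpow_natCast,
    ← Real.rpow_mul hu.le]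
  norm_num

/-- With `l = u⁻²` the term `lX` is 1 and each coordinate costs at most `D u^(2a)`. The value of `a`
makes `2a/s + 1/t < 1`, so `d u^(2a)` is negligible against `u^s + d^t`. -/
theorem isWTst_sobolevEmbedding_of_one_lt_right {b : ℕ → ℝ} {β : ℝ} (hβ : 0 < β)
    (hb : ∀ j : ℕ, β ≤ b (j + 1)) {s t : ℝ} (hs : 0 < s) (ht : 1 < t) :
    IsWTst s t (sobolevEmbedding b) := by
  have hb0 : ∀ j : ℕ, 0 < b (j + 1) := fun j => hβ.trans_le (hb j)
  obtain ⟨C, A, hC, hA, hmain⟩ := exists_log_card_frequencies_le hβ hb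
  have ht0 : 0 < t := by linarith
  have ht1 : 0 < 1 - 1 / t := by rw [sub_pos, div_lt_one ht0]; exact ht
  obtain ⟨D, hD, hDle⟩ := exists_laplaceTerm_mul_le hC hA
    (a := s * (1 - 1 / t) / 4) (by positivity)
  set a := s * (1 - 1 / t) / 4 with ha
  refine isWTst_sobolevEmbedding_of_log_le hb0 hs ht0 fun η hη => ?_
  have hexp : 2 * a / s + 1 / t < 1 := by
    have : 2 * a / s = (1 - 1 / t) / 2 := by rw [ha]; field_simp; ring
    linarith
  obtain ⟨C', -, hC'⟩ := exists_rpow_mul_rpow_le hs ht0 (by positivity : 0 ≤ 2 * a) zero_le_one hexp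
    (by positivity : 0 < η / D)
  refine ⟨1 + D * C', fun u d hu hd => ?_⟩
  have hu0 : 0 < u := by linarith
  have h1 := hmain d (u ^ 2) (u ^ 2)⁻¹ (by nlinarith) (by positivity)
  rw [inv_mul_cancel₀ (by positivity)] at h1
  have h2 : ∑ j ∈ Finset.range d, laplaceTerm C A ((u ^ 2)⁻¹ * (2 * Real.pi) ^ (2 * b (j + 1))) ≤
      d * (D * u ^ (2 * a)) := by
    refine (Finset.sum_le_card_nsmul _ _ (D * u ^ (2 * a)) fun j _ => ?_).trans_eq (by simp)
    rw [← inv_sq_rpow_neg hu0]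
    exact hDle _ _ (by positivity) (one_le_two_pi_rpow (hb0 j))
  have h3 := mul_le_mul_of_nonneg_left (hC' u d hu.le (by exact_mod_cast hd)) hD.le
  rw [Real.rpow_one] at h3
  have h4 : D * (η / D * (u ^ s + (d : ℝ) ^ t) + C') = η * (u ^ s + (d : ℝ) ^ t) + D * C' := by
    field_simp
  linarith

/-- With `l = 1 + 2 log d` each coordinate costs at most `C/d`, so the sum is bounded, and `lX` is
at most a multiple of `d^τ u²`, where `2/s + τ/t < 1`. -/
theorem isWTst_sobolevEmbedding_of_two_lt_left {b : ℕ → ℝ} {β : ℝ} (hβ : 0 < β)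
    (hb : ∀ j : ℕ, β ≤ b (j + 1)) {s t : ℝ} (hs : 2 < s) (ht : 0 < t) :
    IsWTst s t (sobolevEmbedding b) := by
  have hb0 : ∀ j : ℕ, 0 < b (j + 1) := fun j => hβ.trans_le (hb j)
  obtain ⟨C, A, hC, hA, hmain⟩ := exists_log_card_frequencies_le hβ hb
  have hs0 : 0 < s := by linarith
  have hs1 : 0 < 1 - 2 / s := by rw [sub_pos, div_lt_one hs0]; exact hs
  set τ := t * (1 - 2 / s) / 2 with hτ
  have hτ0 : 0 < τ := by positivity
  refine isWTst_sobolevEmbedding_of_log_le hb0 hs0 ht fun η hη => ?_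
  have hexp : 2 / s + τ / t < 1 := by
    have : τ / t = (1 - 2 / s) / 2 := by rw [hτ]; field_simp
    linarith
  set D := 1 + 2 / τ with hD
  have hD0 : 0 < D := by positivity
  obtain ⟨C', -, hC'⟩ := exists_rpow_mul_rpow_le hs0 ht zero_le_two hτ0.le hexp
    (by positivity : 0 < η / D)
  refine ⟨D * C' + C, fun u d hu hd => ?_⟩
  have hu0 : 0 < u := by linarith
  have hd1 : (1 : ℝ) ≤ d := by exact_mod_cast hd
  have hlog : 0 ≤ Real.log d := Real.log_nonneg hd1
  set l := 1 + 2 * Real.log d with hl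
  have hl1 : 1 ≤ l := by linarith
  have h1 := hmain d (u ^ 2) l (by nlinarith) (by positivity)
  have h2 : ∑ j ∈ Finset.range d, laplaceTerm C A (l * (2 * Real.pi) ^ (2 * b (j + 1))) ≤ C := by
    have h3 : ∀ j ∈ Finset.range d, laplaceTerm C A (l * (2 * Real.pi) ^ (2 * b (j + 1))) ≤
        C * (d : ℝ)⁻¹ := by
      intro j _
      have hc := one_le_two_pi_rpow (hb0 j)
      have hy : l ≤ l * (2 * Real.pi) ^ (2 * b (j + 1)) :=
        le_mul_of_one_le_right (by linarith) hc
      set y := l * (2 * Real.pi) ^ (2 * b (j + 1))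
      refine (laplaceTerm_le hC (by linarith)).trans ?_
      have h4 : y ^ (-A) ≤ 1 := Real.rpow_le_one_of_one_le_of_nonpos (by linarith) (by linarith)
      have h5 : Real.exp (-y / 2) ≤ (d : ℝ)⁻¹ := by
        rw [← Real.exp_log (by linarith : (0 : ℝ) < d), ← Real.exp_neg]
        exact Real.exp_le_exp.2 (by linarith)
      calc C * y ^ (-A) * Real.exp (-y / 2) ≤ C * 1 * (d : ℝ)⁻¹ := by gcongr
        _ = _ := by rw [mul_one]
    refine (Finset.sum_le_card_nsmul _ _ _ h3).trans_eq ?_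
    rw [Finset.card_range, nsmul_eq_mul]
    field_simp
  have h6 : l ≤ D * (d : ℝ) ^ τ := by
    have h7 := Real.log_le_rpow_div (by linarith : (0 : ℝ) ≤ d) hτ0
    have h8 : 1 ≤ (d : ℝ) ^ τ := Real.one_le_rpow hd1 hτ0.le
    have h9 : D * (d : ℝ) ^ τ = (d : ℝ) ^ τ + 2 * ((d : ℝ) ^ τ / τ) := by rw [hD]; ring
    linarith
  have h10 := mul_le_mul_of_nonneg_left (hC' u d hu.le hd1) hD0.le
  rw [Real.rpow_two] at h10
  have h11 : D * (η / D * (u ^ s + (d : ℝ) ^ t) + C') = η * (u ^ s + (d : ℝ) ^ t) + D * C' := by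
    field_simp
  have h12 : l * u ^ 2 ≤ D * (d : ℝ) ^ τ * u ^ 2 := by gcongr
  linarith

/-- Once `b_j ≥ log j / (a log 2π)`, the term is at most `j⁻²`. -/
lemma summable_two_pi_rpow_neg {b : ℕ → ℝ}
    (h : Tendsto (fun j : ℕ => b j / Real.log j) atTop atTop) {a : ℝ} (ha : 0 < a) :
    Summable fun j : ℕ => ((2 * Real.pi) ^ (2 * b j)) ^ (-a) := by
  have hlog : 0 < Real.log (2 * Real.pi) := Real.log_pos one_lt_two_pi
  have hpi : 0 < 2 * Real.pi := by positivity
  refine Summable.of_norm_bounded_eventually_nat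
    (Real.summable_nat_pow_inv.2 one_lt_two : Summable fun j : ℕ => ((j : ℝ) ^ 2)⁻¹) ?_
  filter_upwards [h.eventually_ge_atTop (a * Real.log (2 * Real.pi))⁻¹, eventually_ge_atTop 2]
    with j hj hj2
  have hj0 : (1 : ℝ) < j := by exact_mod_cast hj2
  have hlj : 0 < Real.log j := Real.log_pos hj0
  rw [le_div_iff₀ hlj, inv_mul_le_iff₀ (by positivity)] at hj
  rw [Real.norm_of_nonneg (by positivity), ← Real.exp_log (by positivity : (0 : ℝ) < ((j : ℝ) ^ 2)⁻¹),
    ← Real.rpow_mul hpi.le, Real.rpow_def_of_pos hpi, Real.log_inv, Real.log_pow]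
  refine Real.exp_le_exp.2 ?_
  push_cast
  linarith

/-- With `l = u⁻²` and `a = s/4` the sum is at most `D u^(s/2) ∑ c_j^(-a)`; the series converges, so
`d` drops out. -/
theorem isUWT_sobolevEmbedding_of_tendsto {b : ℕ → ℝ} {β : ℝ} (hβ : 0 < β)
    (hb : ∀ j : ℕ, β ≤ b (j + 1))
    (h : Tendsto (fun j : ℕ => b j / Real.log j) atTop atTop) :
    IsUWT (sobolevEmbedding b) := by
  intro s t hs ht
  change IsWTst s t (sobolevEmbedding b)
  have hb0 : ∀ j : ℕ, 0 < b (j + 1) := fun j => hβ.trans_le (hb j)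
  obtain ⟨C, A, hC, hA, hmain⟩ := exists_log_card_frequencies_le hβ hb
  obtain ⟨D, hD, hDle⟩ := exists_laplaceTerm_le_rpow hC hA (a := s / 4) (by positivity)
  have hsum := (summable_nat_add_iff 1).2 (summable_two_pi_rpow_neg h (a := s / 4) (by positivity))
  set S := ∑' j : ℕ, ((2 * Real.pi) ^ (2 * b (j + 1))) ^ (-(s / 4)) with hS
  have hS0 : 0 < S := hsum.tsum_pos (fun j => by positivity) 0 (by positivity)
  refine isWTst_sobolevEmbedding_of_log_le hb0 hs ht fun η hη => ?_
  have hexp : s / 2 / s + 0 / t < 1 := by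
    have : s / 2 / s = 1 / 2 := by field_simp
    rw [this, zero_div]
    norm_num
  obtain ⟨C', -, hC'⟩ := exists_rpow_mul_rpow_le hs ht (by positivity : 0 ≤ s / 2) le_rfl hexp
    (by positivity : 0 < η / (D * S))
  refine ⟨1 + D * S * C', fun u d hu hd => ?_⟩
  have hu0 : 0 < u := by linarith
  have h1 := hmain d (u ^ 2) (u ^ 2)⁻¹ (by nlinarith) (by positivity)
  rw [inv_mul_cancel₀ (by positivity)] at h1
  have h2 : ∑ j ∈ Finset.range d, laplaceTerm C A ((u ^ 2)⁻¹ * (2 * Real.pi) ^ (2 * b (j + 1))) ≤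
      D * u ^ (s / 2) * S := by
    calc _ ≤ ∑ j ∈ Finset.range d,
          D * u ^ (s / 2) * ((2 * Real.pi) ^ (2 * b (j + 1))) ^ (-(s / 4)) := by
          refine Finset.sum_le_sum fun j _ => (hDle _ (by positivity)).trans_eq ?_
          rw [Real.mul_rpow (by positivity) (by positivity), inv_sq_rpow_neg hu0, mul_assoc]
          congr 3
          ring
      _ ≤ _ := by
          rw [← Finset.mul_sum]
          exact mul_le_mul_of_nonneg_left
            (hsum.sum_le_tsum _ fun j _ => by positivity) (by positivity)
  have h3 := mul_le_mul_of_nonneg_left (hC' u d hu.le (by exact_mod_cast hd))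
    (by positivity : 0 ≤ D * S)
  rw [Real.rpow_zero, mul_one] at h3
  have h4 : D * S * (η / (D * S) * (u ^ s + (d : ℝ) ^ t) + C') =
      η * (u ^ s + (d : ℝ) ^ t) + D * S * C' := by
    field_simp
  linarith

lemma tendsto_two_pi_rpow_iff {b : ℕ → ℝ} :
    Tendsto (fun j : ℕ => (2 * Real.pi) ^ (2 * b j)) atTop atTop ↔ Tendsto b atTop atTop := by
  have hlog : 0 < Real.log (2 * Real.pi) := Real.log_pos one_lt_two_pi
  have hpi : 0 < 2 * Real.pi := by positivity
  have h1 : (fun j : ℕ => (2 * Real.pi) ^ (2 * b j)) =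
      Real.exp ∘ fun j => Real.log (2 * Real.pi) * 2 * b j := by
    funext j
    rw [Real.rpow_def_of_pos hpi, Function.comp_apply, mul_assoc]
  rw [h1]
  change Tendsto (fun j => Real.exp (Real.log (2 * Real.pi) * 2 * b j)) atTop atTop ↔ _
  rw [Real.tendsto_exp_comp_atTop, tendsto_const_mul_atTop_of_pos (by positivity)]

/-- With `l = η` the coordinate costs tend to 0, so their sum is at most `η d + C'`, while `lX = η
u²`. -/
theorem isWTst_two_one_of_tendsto {b : ℕ → ℝ} {β : ℝ} (hβ : 0 < β)
    (hb : ∀ j : ℕ, β ≤ b (j + 1)) (h : Tendsto b atTop atTop) :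
    IsWTst 2 1 (sobolevEmbedding b) := by
  have hb0 : ∀ j : ℕ, 0 < b (j + 1) := fun j => hβ.trans_le (hb j)
  obtain ⟨C, A, hC, hA, hmain⟩ := exists_log_card_frequencies_le hβ hb
  obtain ⟨D, hD, hDle⟩ := exists_laplaceTerm_le_rpow hC hA one_pos
  refine isWTst_sobolevEmbedding_of_log_le hb0 two_pos one_pos fun η hη => ?_
  have hzero : Tendsto (fun j : ℕ => laplaceTerm C A (η * (2 * Real.pi) ^ (2 * b (j + 1))))
      atTop (𝓝 0) := by
    have h1 : Tendsto (fun j : ℕ => η * (2 * Real.pi) ^ (2 * b (j + 1))) atTop atTop :=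
      ((tendsto_two_pi_rpow_iff.2 h).comp (tendsto_add_atTop_nat 1)).const_mul_atTop hη
    have h2 := ((tendsto_rpow_neg_atTop one_pos).comp h1).const_mul D
    rw [mul_zero] at h2
    exact squeeze_zero (fun j => laplaceTerm_nonneg hC (by positivity))
      (fun j => hDle _ (by positivity)) h2
  obtain ⟨C', hC'⟩ := exists_sum_range_le_of_tendsto_zero hzero hη
  refine ⟨C', fun u d hu hd => ?_⟩
  have h1 := hmain d (u ^ 2) η (by nlinarith) hη
  have h2 := hC' d
  rw [Real.rpow_two, Real.rpow_one]
  linarith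

/-- With `l = η`, eventually `c_j ≥ (4/η) log j`, hence `exp (-η c_j / 2) ≤ j⁻²` and the coordinate
costs are summable. -/
theorem isWTst_two_of_tendsto {b : ℕ → ℝ} {β : ℝ} (hβ : 0 < β)
    (hb : ∀ j : ℕ, β ≤ b (j + 1))
    (h : Tendsto (fun j : ℕ => (2 * Real.pi) ^ (2 * b j) / Real.log j) atTop atTop) {t : ℝ}
    (ht : 0 < t) : IsWTst 2 t (sobolevEmbedding b) := by
  have hb0 : ∀ j : ℕ, 0 < b (j + 1) := fun j => hβ.trans_le (hb j)
  obtain ⟨C, A, hC, hA, hmain⟩ := exists_log_card_frequencies_le hβ hb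
  refine isWTst_sobolevEmbedding_of_log_le hb0 two_pos ht fun η hη => ?_
  have hsum : Summable fun j : ℕ => laplaceTerm C A (η * (2 * Real.pi) ^ (2 * b j)) := by
    have h2 : Summable fun j : ℕ => C * η ^ (-A) * ((j : ℝ) ^ 2)⁻¹ :=
      (Real.summable_nat_pow_inv.2 one_lt_two).mul_left _
    refine h2.of_norm_bounded_eventually_nat ?_
    filter_upwards [h.eventually_ge_atTop (4 / η), eventually_ge_atTop 2] with j hj hj2
    have hj0 : (1 : ℝ) < j := by exact_mod_cast hj2
    have hlj : 0 < Real.log j := Real.log_pos hj0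
    have hc : 1 ≤ (2 * Real.pi) ^ (2 * b j) := by
      have := hb0 (j - 1)
      rw [Nat.sub_add_cancel (by omega)] at this
      exact one_le_two_pi_rpow this
    set c := (2 * Real.pi) ^ (2 * b j)
    rw [le_div_iff₀ hlj, div_mul_eq_mul_div, div_le_iff₀ hη] at hj
    rw [Real.norm_of_nonneg (laplaceTerm_nonneg hC (by positivity))]
    refine (laplaceTerm_le hC (by positivity)).trans ?_
    have h3 : (η * c) ^ (-A) ≤ η ^ (-A) :=
      Real.rpow_le_rpow_of_nonpos hη (le_mul_of_one_le_right hη.le hc) (by linarith)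
    have h4 : Real.exp (-(η * c) / 2) ≤ ((j : ℝ) ^ 2)⁻¹ := by
      rw [← Real.exp_log (by positivity : (0 : ℝ) < ((j : ℝ) ^ 2)⁻¹), Real.log_inv, Real.log_pow]
      refine Real.exp_le_exp.2 ?_
      push_cast
      linarith
    gcongr
  have hsum' := (summable_nat_add_iff 1).2 hsum
  refine ⟨∑' j : ℕ, laplaceTerm C A (η * (2 * Real.pi) ^ (2 * b (j + 1))), fun u d hu hd => ?_⟩
  have h5 := hsum'.sum_le_tsum (Finset.range d) fun j _ => laplaceTerm_nonneg hC (by positivity)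
  have h6 : 0 ≤ η * (d : ℝ) ^ t := by positivity
  have h7 := hmain d (u ^ 2) η (by nlinarith) hη
  rw [Real.rpow_two]
  linarith

/-- With `l = η u^(s-2)` one has `lX = η u^s`. For `Q = η u^s / (4D)`, growth of `c_j` makes the
cost of coordinate `j + 1` at most `D min(√z, z²)` at `z = Q/(j+1)`, and these sum to at most `4DQ =
η u^s`. The finitely many early coordinates cost only a multiple of `u^(s/2)`. -/
theorem isWTst_of_tendsto_of_lt_two {b : ℕ → ℝ} {β : ℝ} (hβ : 0 < β)
    (hb : ∀ j : ℕ, β ≤ b (j + 1)) {s t : ℝ} (hs : 0 < s) (hs2 : s < 2) (ht : 0 < t)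
    (h : Tendsto (fun j : ℕ => (2 * Real.pi) ^ (2 * b j) / (j : ℝ) ^ ((2 - s) / s)) atTop atTop) :
    IsWTst s t (sobolevEmbedding b) := by
  have hb0 : ∀ j : ℕ, 0 < b (j + 1) := fun j => hβ.trans_le (hb j)
  obtain ⟨C, A, hC, hA, hmain⟩ := exists_log_card_frequencies_le hβ hb
  have hs' : 0 < 2 - s := sub_pos.2 hs2
  set γ := (2 - s) / s with hγ
  have hγ0 : 0 < γ := by positivity
  obtain ⟨D₁, hD₁, hle₁⟩ := exists_laplaceTerm_le_rpow hC hA (a := 1 / (2 * γ)) (by positivity)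
  obtain ⟨D₂, hD₂, hle₂⟩ := exists_laplaceTerm_le_rpow hC hA (a := 2 / γ) (by positivity)
  obtain ⟨D₃, hD₃, hle₃⟩ := exists_laplaceTerm_mul_le hC hA
    (a := s / (2 * (2 - s))) (by positivity)
  set D := max D₁ D₂ with hD
  have hD0 : 0 < D := lt_max_of_lt_left hD₁
  -- The two exponents `1/(2γ)` and `2/γ` become `1/2` and `2` after substituting `y ≥ z^(-γ)`.
  have htail : ∀ z y : ℝ, 0 < z → z ^ (-γ) ≤ y → laplaceTerm C A y ≤ D * min √z (z ^ 2) := by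
    intro z y hz hy
    have hy0 : 0 < y := lt_of_lt_of_le (by positivity) hy
    have key : ∀ a : ℝ, 0 < a → y ^ (-a) ≤ z ^ (γ * a) := by
      intro a ha
      refine (Real.rpow_le_rpow_of_nonpos (by positivity) hy (by linarith)).trans_eq ?_
      rw [← Real.rpow_mul hz.le, neg_mul_neg]
    rw [mul_min_of_nonneg _ _ hD0.le]
    refine le_min ?_ ?_
    · have h1 := key (1 / (2 * γ)) (by positivity)
      have h2 : γ * (1 / (2 * γ)) = 1 / 2 := by field_simp
      rw [h2, ← Real.sqrt_eq_rpow] at h1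
      calc _ ≤ D₁ * y ^ (-(1 / (2 * γ))) := hle₁ y hy0
        _ ≤ D * √z := by
          gcongr
          exact le_max_left _ _
    · have h1 := key (2 / γ) (by positivity)
      have h2 : γ * (2 / γ) = 2 := by field_simp
      rw [h2, Real.rpow_two] at h1
      calc _ ≤ D₂ * y ^ (-(2 / γ)) := hle₂ y hy0
        _ ≤ D * z ^ 2 := by
          gcongr
          exact le_max_right _ _
  refine isWTst_sobolevEmbedding_of_log_le hb0 hs ht fun η' hη' => ?_
  -- One share of `η` each for `lX`, the tail and the early coordinates.
  obtain ⟨η, hη, rfl⟩ : ∃ η, 0 < η ∧ 3 * η = η' := ⟨η' / 3, by positivity, by ring⟩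
  -- `K` is so large that `4 D (η K) ^ (-1 / γ) = η`
  set K := (η / (4 * D)) ^ (-γ) / η with hK
  have hK0 : 0 < K := by positivity
  obtain ⟨J, hJ⟩ := eventually_atTop.1 ((h.eventually_ge_atTop K).and (eventually_ge_atTop 1))
  have hexp : s / 2 / s + 0 / t < 1 := by
    have : s / 2 / s = 1 / 2 := by field_simp
    rw [this, zero_div]
    norm_num
  set E := J * (D₃ * η ^ (-(s / (2 * (2 - s))))) + 1 with hE
  have hE0 : 0 < E := by positivity
  obtain ⟨C', hC'0, hC'⟩ := exists_rpow_mul_rpow_le hs ht (by positivity : 0 ≤ s / 2) le_rfl hexp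
    (by positivity : 0 < η / E)
  refine ⟨E * C', fun u d hu hd => ?_⟩
  have hu0 : 0 < u := by linarith
  have hd0 : (0 : ℝ) ≤ d := Nat.cast_nonneg d
  set l := η * u ^ (s - 2) with hl
  have hl0 : 0 < l := by positivity
  have h1 := hmain d (u ^ 2) l (by nlinarith) hl0
  have hlX : l * u ^ 2 = η * u ^ s := by
    rw [hl, mul_assoc, ← Real.rpow_two, ← Real.rpow_add hu0]
    congr 2
    ring
  set Q := η / (4 * D) * u ^ s with hQ
  have hQ0 : 0 < Q := by positivity
  have hQγ : Q ^ (-γ) = l * K := by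
    rw [hQ, Real.mul_rpow (by positivity) (by positivity), ← Real.rpow_mul hu0.le, hl, hK]
    have : s * -γ = s - 2 := by rw [hγ]; field_simp; ring
    rw [this]
    field_simp
  have hhead : l ^ (-(s / (2 * (2 - s)))) = η ^ (-(s / (2 * (2 - s)))) * u ^ (s / 2) := by
    rw [hl, Real.mul_rpow hη.le (by positivity), ← Real.rpow_mul hu0.le]
    congr 2
    field_simp
    ring
  have h2 : ∀ j ∈ Finset.range d, laplaceTerm C A (l * (2 * Real.pi) ^ (2 * b (j + 1))) ≤
      (if j ∈ Finset.range J then D₃ * η ^ (-(s / (2 * (2 - s)))) * u ^ (s / 2) else 0) +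
      D * min √(Q / ((j : ℝ) + 1)) ((Q / ((j : ℝ) + 1)) ^ 2) := by
    intro j _
    by_cases hjJ : j < J
    · rw [if_pos (Finset.mem_range.2 hjJ)]
      have h3 := hle₃ l _ hl0 (one_le_two_pi_rpow (hb0 j))
      rw [hhead, ← mul_assoc] at h3
      have h4 : 0 ≤ D * min √(Q / ((j : ℝ) + 1)) ((Q / ((j : ℝ) + 1)) ^ 2) := by positivity
      linarith
    · rw [if_neg (by rwa [Finset.mem_range]), zero_add]
      refine htail _ _ (by positivity) ?_
      have h3 := (hJ (j + 1) (by omega)).1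
      have hj0 : (0 : ℝ) < ((j + 1 : ℕ) : ℝ) := by positivity
      rw [le_div_iff₀ (by positivity)] at h3
      push_cast at h3
      rw [Real.div_rpow hQ0.le (by positivity), hQγ, Real.rpow_neg (by positivity), div_inv_eq_mul,
        mul_assoc]
      exact mul_le_mul_of_nonneg_left h3 hl0.le
  have h5 : ∑ j ∈ Finset.range d, laplaceTerm C A (l * (2 * Real.pi) ^ (2 * b (j + 1))) ≤
      E * u ^ (s / 2) + η * u ^ s := by
    refine (Finset.sum_le_sum h2).trans ?_
    rw [Finset.sum_add_distrib]
    refine add_le_add ?_ ?_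
    · rw [Finset.sum_ite_mem, Finset.sum_const, nsmul_eq_mul]
      have h6 : ((Finset.range d ∩ Finset.range J).card : ℝ) ≤ J := by
        have := Finset.card_le_card (Finset.inter_subset_right :
          Finset.range d ∩ Finset.range J ⊆ Finset.range J)
        rw [Finset.card_range] at this
        exact_mod_cast this
      calc _ ≤ (J : ℝ) * (D₃ * η ^ (-(s / (2 * (2 - s)))) * u ^ (s / 2)) := by gcongr
        _ = (E - 1) * u ^ (s / 2) := by rw [hE]; ring
        _ ≤ E * u ^ (s / 2) := by
          gcongr
          linarith
    · rw [← Finset.mul_sum]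
      calc _ ≤ D * (4 * Q) := by
            gcongr
            exact sum_min_sqrt_sq_le hQ0 d
        _ = η * u ^ s := by rw [hQ]; field_simp
  have h7 := mul_le_mul_of_nonneg_left (hC' u d hu.le (by exact_mod_cast hd)) hE0.le
  rw [Real.rpow_zero, mul_one] at h7
  have h8 : E * (η / E * (u ^ s + (d : ℝ) ^ t) + C') = η * (u ^ s + (d : ℝ) ^ t) + E * C' := by
    field_simp
  have h9 : 0 ≤ η * (d : ℝ) ^ t := by positivity
  linarith

end Sufficiency


/-! ### Necessary conditions, and the polynomial notions -/

section Necessity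

/-- If `c_d < K d^((2-s)/s)` for a large `d`, then `X = 2 + d c_d` is at most `(2 + K) d^(2/s)` and
admits all `2^d` 0-1 vectors. But `X^(s/2) + d^t ≤ E d`, so `η = log 2 / (2E)` would force `d log 2
≤ (d log 2)/2`. The case `s = 2` is included, with exponent 0. -/
lemma IsWTst.tendsto_two_pi_rpow_div {b : ℕ → ℝ} (hb : ∀ j : ℕ, 0 < b (j + 1))
    (hb_mono : ∀ i j : ℕ, 1 ≤ i → i ≤ j → b i ≤ b j) {s t : ℝ} (hs : 0 < s) (ht1 : t ≤ 1)
    (h : IsWTst s t (sobolevEmbedding b)) :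
    Tendsto (fun j : ℕ => (2 * Real.pi) ^ (2 * b j) / (j : ℝ) ^ ((2 - s) / s)) atTop atTop := by
  rw [tendsto_atTop]
  intro K₀
  obtain ⟨K, hK, hK₀⟩ : ∃ K : ℝ, 1 ≤ K ∧ K₀ ≤ K := ⟨max K₀ 1, le_max_right _ _, le_max_left _ _⟩
  have hlog2 : 0 < Real.log 2 := Real.log_pos one_lt_two
  set E := (2 + K) ^ (s / 2) + 1 with hE
  have hE0 : 0 < E := by positivity
  filter_upwards [h.exists_log_card_frequencies_le hb (η := Real.log 2 / (2 * E)) (by positivity),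
    eventually_ge_atTop 1] with d hd hd1
  refine hK₀.trans ?_
  have hd1' : (1 : ℝ) ≤ d := by exact_mod_cast hd1
  have hd0 : (0 : ℝ) < d := by linarith
  rw [le_div_iff₀ (by positivity)]
  by_contra! hlt
  set c := (2 * Real.pi) ^ (2 * b d)
  have hc0 : 0 < c := by positivity
  set X := 2 + d * c with hX
  have hdc : 0 < d * c := by positivity
  have h1 := hd X (by linarith)
  have h2 : (2 : ℝ) ^ d ≤ (frequencies b d X).card := by
    exact_mod_cast two_pow_le_card_frequencies hb hb_mono (by rw [hX]; linarith)
  have h3 := Real.log_le_log (by positivity) h2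
  rw [Real.log_pow] at h3
  have h4 : X ≤ (2 + K) * (d : ℝ) ^ (2 / s) := by
    have h5 : (d : ℝ) ^ (2 / s) = d * (d : ℝ) ^ ((2 - s) / s) := by
      have : 2 / s = 1 + (2 - s) / s := by
        field_simp
        ring
      rw [this, Real.rpow_add hd0, Real.rpow_one]
    have h6 : 1 ≤ (d : ℝ) ^ (2 / s) := Real.one_le_rpow hd1' (by positivity)
    have h7 : d * c ≤ d * (K * (d : ℝ) ^ ((2 - s) / s)) := by gcongr
    have h8 : d * (K * (d : ℝ) ^ ((2 - s) / s)) = K * (d : ℝ) ^ (2 / s) := by rw [h5]; ring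
    rw [hX]
    linarith
  have h9 : X ^ (s / 2) ≤ (2 + K) ^ (s / 2) * d := by
    refine (Real.rpow_le_rpow (by positivity) h4 (by positivity)).trans_eq ?_
    rw [Real.mul_rpow (by positivity) (by positivity), ← Real.rpow_mul hd0.le]
    have : 2 / s * (s / 2) = 1 := by field_simp
    rw [this, Real.rpow_one]
  have h10 : (d : ℝ) ^ t ≤ d := by
    simpa using Real.rpow_le_rpow_of_exponent_le hd1' ht1
  have h11 : Real.log 2 / (2 * E) * (X ^ (s / 2) + (d : ℝ) ^ t) ≤
      Real.log 2 / (2 * E) * (E * d) := by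
    gcongr
    rw [hE, add_mul, one_mul]
    exact add_le_add h9 h10
  have h12 : Real.log 2 / (2 * E) * (E * d) = d * Real.log 2 / 2 := by field_simp
  have h13 : 0 < d * Real.log 2 := by positivity
  linarith

/-- From `d.choose m ≥ (d+1-m)^m / m!`, using `d+1-m ≥ d/2` and `m! ≤ m^m`. -/
lemma div_pow_le_choose {d m : ℕ} (hm : 1 ≤ m) (hmd : 2 * m ≤ d) :
    ((d : ℝ) / (2 * m)) ^ m ≤ d.choose m := by
  have hm0 : (0 : ℝ) < m := by exact_mod_cast hm
  have h1 := Nat.pow_le_choose (α := ℝ) m d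
  refine le_trans ?_ h1
  have h2 : (Nat.factorial m : ℝ) ≤ (m : ℝ) ^ m := by exact_mod_cast Nat.factorial_le_pow m
  have h3 : (d : ℝ) / 2 ≤ ((d + 1 - m : ℕ) : ℝ) := by
    have h4 : 2 * (d + 1 - m) ≥ d := by omega
    have h5 : (d : ℝ) ≤ 2 * ((d + 1 - m : ℕ) : ℝ) := by exact_mod_cast h4
    linarith
  calc ((d : ℝ) / (2 * m)) ^ m = ((d : ℝ) / 2) ^ m / (m : ℝ) ^ m := by
        rw [← div_pow, div_div]
    _ ≤ (((d + 1 - m : ℕ) : ℝ)) ^ m / Nat.factorial m := by gcongr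
    _ = _ := rfl

/-- All `2^d` vectors would give no logarithm; sparse ones do. For `m ≈ d^(1-σ)`, `log (d.choose m)`
is at least `(σ/2) m log d`. If `c_d < K log d`, then `X = 2 + m c_d` and `d^t` are at most constant
multiples of `m log d`, contradicting tractability for small `η`. -/
lemma IsWTst.tendsto_two_pi_rpow_div_log {b : ℕ → ℝ} (hb : ∀ j : ℕ, 0 < b (j + 1))
    (hb_mono : ∀ i j : ℕ, 1 ≤ i → i ≤ j → b i ≤ b j) {t : ℝ} (ht : 0 < t) (ht1 : t < 1)
    (h : IsWTst 2 t (sobolevEmbedding b)) :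
    Tendsto (fun j : ℕ => (2 * Real.pi) ^ (2 * b j) / Real.log j) atTop atTop := by
  rw [tendsto_atTop]
  intro K₀
  obtain ⟨K, hK, hK₀⟩ : ∃ K : ℝ, 1 ≤ K ∧ K₀ ≤ K := ⟨max K₀ 1, le_max_right _ _, le_max_left _ _⟩
  have hδ : 0 < 1 - t := by linarith
  set σ := (1 - t) / 2 with hσ
  have hσ0 : 0 < σ := by positivity
  filter_upwards [h.exists_log_card_frequencies_le hb (η := σ / (4 * (4 + K))) (by positivity),
    eventually_ge_atTop 1,
    (Real.tendsto_log_atTop.comp tendsto_natCast_atTop_atTop).eventually_ge_atTop 1,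
    ((tendsto_rpow_atTop (half_pos hσ0)).comp tendsto_natCast_atTop_atTop).eventually_ge_atTop 2]
    with d hd hd1 hlog hpow
  simp only [Function.comp_apply] at hlog hpow
  refine hK₀.trans ?_
  have hd1' : (1 : ℝ) ≤ d := by exact_mod_cast hd1
  have hd0 : (0 : ℝ) < d := by linarith
  rw [le_div_iff₀ (by linarith)]
  by_contra! hlt
  set c := (2 * Real.pi) ^ (2 * b d)
  have hc0 : 0 < c := by positivity
  set L := Real.log d with hL
  -- `m ≈ d ^ (1 - σ)` with `t < 1 - σ < 1`
  set m := ⌊(d : ℝ) ^ (1 - σ)⌋₊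
  have hm_le : (m : ℝ) ≤ (d : ℝ) ^ (1 - σ) := Nat.floor_le (by positivity)
  have hm_lt : (d : ℝ) ^ (1 - σ) < m + 1 := Nat.lt_floor_add_one _
  have hm1 : 1 ≤ m := Nat.le_floor (by
    rw [Nat.cast_one]
    exact Real.one_le_rpow hd1' (by linarith))
  have hm1' : (1 : ℝ) ≤ m := by exact_mod_cast hm1
  have hsplit : (d : ℝ) ^ (1 - σ) * ((d : ℝ) ^ (σ / 2) * (d : ℝ) ^ (σ / 2)) = d := by
    rw [← Real.rpow_add hd0, ← Real.rpow_add hd0]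
    have : 1 - σ + (σ / 2 + σ / 2) = 1 := by ring
    rw [this, Real.rpow_one]
  set p := (d : ℝ) ^ (σ / 2) with hp
  -- Of the two factors `p = d^(σ/2)` in `d / d^(1-σ)`, one absorbs the 2 and the other remains as
  -- the base of the binomial bound.
  have hratio : p * (2 * m) ≤ d := by
    calc p * (2 * m) ≤ p * (p * (d : ℝ) ^ (1 - σ)) := by gcongr
      _ = (d : ℝ) ^ (1 - σ) * (p * p) := by ring
      _ = d := hsplit
  have h2md : 2 * m ≤ d := by
    have : (2 * m : ℝ) ≤ d := by nlinarith
    exact_mod_cast this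
  set X := 2 + m * c with hX
  have hmc : 0 < m * c := by positivity
  have h1 := hd X (by linarith)
  have h2 : (p : ℝ) ^ m ≤ (frequencies b d X).card := by
    calc p ^ m ≤ ((d : ℝ) / (2 * m)) ^ m := by
          gcongr
          rw [le_div_iff₀ (by positivity)]
          exact hratio
      _ ≤ d.choose m := div_pow_le_choose hm1 h2md
      _ ≤ _ := by exact_mod_cast choose_le_card_frequencies hb hb_mono (by rw [hX]; linarith)
  have h3 := Real.log_le_log (by positivity) h2
  rw [Real.log_pow, hp, Real.log_rpow hd0, ← hL] at h3
  have hmL : (m : ℝ) ≤ m * L := le_mul_of_one_le_right (by positivity) hlog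
  have h4 : X ≤ (2 + K) * (m * L) := by
    have h5 : m * c ≤ m * (K * L) := by gcongr
    have h6 : (m : ℝ) * (K * L) = K * (m * L) := by ring
    rw [hX]
    linarith
  have h7 : (d : ℝ) ^ t ≤ 2 * (m * L) := by
    have h8 : (d : ℝ) ^ t ≤ (d : ℝ) ^ (1 - σ) :=
      Real.rpow_le_rpow_of_exponent_le hd1' (by rw [hσ]; linarith)
    linarith
  rw [div_self two_ne_zero, Real.rpow_one] at h1
  have h9 : σ / (4 * (4 + K)) * (X + (d : ℝ) ^ t) ≤ σ / (4 * (4 + K)) * ((4 + K) * (m * L)) := by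
    gcongr
    linarith
  have h10 : σ / (4 * (4 + K)) * ((4 + K) * (m * L)) = m * (σ / 2 * L) / 2 := by
    field_simp
    ring
  have h11 : 0 < m * (σ / 2 * L) := by positivity
  linarith

/-- The value `s = 2/(1+γ)` turns `(2-s)/s` into `γ`, so `c_j ≥ j^γ` eventually for any prescribed
`γ > 0`; then take logarithms. -/
lemma IsUWT.tendsto_div_log {b : ℕ → ℝ} (hb : ∀ j : ℕ, 0 < b (j + 1))
    (hb_mono : ∀ i j : ℕ, 1 ≤ i → i ≤ j → b i ≤ b j) (h : IsUWT (sobolevEmbedding b)) :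
    Tendsto (fun j : ℕ => b j / Real.log j) atTop atTop := by
  have hlog : 0 < Real.log (2 * Real.pi) := Real.log_pos one_lt_two_pi
  rw [tendsto_atTop]
  intro K₀
  obtain ⟨K, hK, hK₀⟩ : ∃ K : ℝ, 1 ≤ K ∧ K₀ ≤ K := ⟨max K₀ 1, le_max_right _ _, le_max_left _ _⟩
  set γ := 2 * K * Real.log (2 * Real.pi) with hγ
  have hγ0 : 0 < γ := by positivity
  have h1 := IsWTst.tendsto_two_pi_rpow_div hb hb_mono (s := 2 / (1 + γ)) (t := 1) (by positivity)
    le_rfl (h _ 1 (by positivity) one_pos)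
  have h2 : (2 - 2 / (1 + γ)) / (2 / (1 + γ)) = γ := by
    field_simp
    ring
  rw [h2] at h1
  filter_upwards [h1.eventually_ge_atTop 1, eventually_ge_atTop 2] with j hj hj2
  have hj0 : (1 : ℝ) < j := by exact_mod_cast hj2
  have hlj : 0 < Real.log j := Real.log_pos hj0
  refine hK₀.trans ?_
  rw [one_le_div (by positivity)] at hj
  have h3 := Real.log_le_log (by positivity) hj
  rw [Real.log_rpow (by linarith), Real.log_rpow (by positivity), hγ] at h3
  rw [le_div_iff₀ hlj]
  nlinarith

/-- For fixed `d` the factor `d^q` is a constant, so `u → ∞` bounds every partial sum by the same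
`p`. -/
lemma IsPT.summable {b : ℕ → ℝ} (hb : ∀ j : ℕ, 0 < b (j + 1)) (h : IsPT (sobolevEmbedding b)) :
    Summable fun j : ℕ => (b (j + 1))⁻¹ := by
  obtain ⟨C, p, q, hC, hp, hq, h⟩ := h
  refine summable_of_sum_range_le (c := p) (fun j => (inv_pos.2 (hb j)).le) fun d => ?_
  rcases Nat.eq_zero_or_pos d with rfl | hd
  · simpa using hp
  obtain ⟨κ, hκ, hle⟩ := exists_mul_rpow_le_card_frequencies hb hd
  refine le_of_mul_rpow_le (D := C * (d : ℝ) ^ q) hκ fun u hu => (hle u hu).trans ?_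
  have h1 := h d hd u⁻¹ (inv_pos.2 (by linarith)) (inv_lt_one_of_one_lt₀ (by linarith))
  rwa [infoComplexity_sobolevEmbedding hb (inv_pos.2 (by linarith)), inv_inv] at h1

lemma isSPT_of_summable {b : ℕ → ℝ} (hb : ∀ j : ℕ, 0 < b (j + 1))
    (h : Summable fun j : ℕ => (b (j + 1))⁻¹) : IsSPT (sobolevEmbedding b) := by
  have hnn : ∀ j : ℕ, 0 ≤ (b (j + 1))⁻¹ := fun j => (inv_pos.2 (hb j)).le
  refine ⟨1, ∑' j : ℕ, (b (j + 1))⁻¹, zero_le_one, tsum_nonneg hnn, fun d _ ε h0 h1 => ?_⟩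
  have hu : 1 < ε⁻¹ := (one_lt_inv₀ h0).2 h1
  rw [infoComplexity_sobolevEmbedding hb h0, one_mul]
  exact (card_frequencies_le_rpow hb d hu.le).trans
    (Real.rpow_le_rpow_of_exponent_le hu.le (h.sum_le_tsum _ fun j _ => hnn j))

lemma sum_Icc_eq_sum_range_succ (f : ℕ → ℝ) (d : ℕ) :
    ∑ j ∈ Finset.Icc 1 d, f j = ∑ j ∈ Finset.range d, f (j + 1) := by
  rw [Finset.range_eq_Ico, Finset.sum_Ico_add' f]
  rfl

/-- As a function of `u`, the QPT bound is a power with exponent `t (1 + log d)`; it is compared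
with the exponent `∑ 1/b_j` of the count. -/
lemma isQPT_iff {b : ℕ → ℝ} (hb : ∀ j : ℕ, 0 < b (j + 1)) :
    IsQPT (sobolevEmbedding b) ↔ ∃ M : ℝ, ∀ d : ℕ, 1 ≤ d →
      (∑ j ∈ Finset.Icc 1 d, (b j)⁻¹) / (1 + Real.log d) ≤ M := by
  have hlog : ∀ d : ℕ, 1 ≤ d → 0 < 1 + Real.log d := fun d hd => by
    have := Real.log_nonneg (by exact_mod_cast hd : (1 : ℝ) ≤ d)
    linarith
  simp only [sum_Icc_eq_sum_range_succ]
  constructor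
  · rintro ⟨C, t, hC, ht, h⟩
    refine ⟨t, fun d hd => ?_⟩
    rw [div_le_iff₀ (hlog d hd)]
    obtain ⟨κ, hκ, hle⟩ := exists_mul_rpow_le_card_frequencies hb hd
    refine le_of_mul_rpow_le (D := C * Real.exp (t * (1 + Real.log d))) hκ
      fun u hu => (hle u hu).trans ?_
    have hu0 : 0 < u := by linarith
    have h1 := h d hd u⁻¹ (inv_pos.2 hu0) (inv_lt_one_of_one_lt₀ (by linarith))
    rw [infoComplexity_sobolevEmbedding hb (inv_pos.2 hu0), inv_inv] at h1
    refine h1.trans_eq ?_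
    rw [Real.rpow_def_of_pos hu0, mul_assoc C, ← Real.exp_add]
    congr 2
    ring
  · rintro ⟨M, hM⟩
    -- The maximum with 1 keeps the exponent `t` positive.
    refine ⟨1, max M 1, one_pos, by positivity, fun d hd ε h0 h1 => ?_⟩
    have hu : 1 < ε⁻¹ := (one_lt_inv₀ h0).2 h1
    rw [infoComplexity_sobolevEmbedding hb h0, one_mul]
    refine (card_frequencies_le_rpow hb d hu.le).trans ?_
    rw [Real.rpow_def_of_pos (by linarith)]
    refine Real.exp_le_exp.2 ?_
    have h2 := hlog d hd
    have h3 := (div_le_iff₀ h2).1 ((hM d hd).trans (le_max_left M 1))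
    have h4 : 0 < Real.log ε⁻¹ := Real.log_pos hu
    have h5 : 0 < max M 1 := by positivity
    calc _ ≤ Real.log ε⁻¹ * (max M 1 * (1 + Real.log d)) := by gcongr
      _ ≤ (1 + Real.log ε⁻¹) * (max M 1 * (1 + Real.log d)) := by
        gcongr
        linarith
      _ = _ := by ring

end Necessity

end AnisoTract

end

/-! ### Assembly of the criteria -/

theorem theorem2p9 (b : ℕ → ℝ) (hb_pos : 0 < b 1)
    (hb_mono : ∀ i j : ℕ, 1 ≤ i → i ≤ j → b i ≤ b j) :
    -- the information complexities are minima over nonempty sets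
    (∀ d : ℕ, 1 ≤ d → ∀ ε : ℝ, 0 < ε → ε < 1 →
      ∃ n : ℕ, AnisoTract.minimalError n (AnisoTract.sobolevEmbedding b d) ≤ ENNReal.ofReal ε) ∧
    -- (i)
    ((AnisoTract.IsSPT (AnisoTract.sobolevEmbedding b) ↔
        AnisoTract.IsPT (AnisoTract.sobolevEmbedding b)) ∧
      (AnisoTract.IsPT (AnisoTract.sobolevEmbedding b) ↔
        Summable (fun j : ℕ => (b (j + 1))⁻¹))) ∧
    -- (ii)
    (AnisoTract.IsQPT (AnisoTract.sobolevEmbedding b) ↔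
      ∃ M : ℝ, ∀ d : ℕ, 1 ≤ d →
        (∑ j ∈ Finset.Icc 1 d, (b j)⁻¹) / (1 + Real.log d) ≤ M) ∧
    -- (iii)
    (AnisoTract.IsUWT (AnisoTract.sobolevEmbedding b) ↔
      Tendsto (fun j : ℕ => b j / Real.log j) atTop atTop) ∧
    -- (iv)
    (AnisoTract.IsWT (AnisoTract.sobolevEmbedding b) ↔
      Tendsto (fun j : ℕ => (2 * Real.pi) ^ (2 * b j) / (j : ℝ)) atTop atTop) ∧
    -- (v)
    (∀ s t : ℝ, 0 < s → 0 < t → 1 < max (s / 2) t →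
      AnisoTract.IsWTst s t (AnisoTract.sobolevEmbedding b)) ∧
    -- (vi)
    (AnisoTract.IsWTst 2 1 (AnisoTract.sobolevEmbedding b) ↔
      Tendsto (fun j : ℕ => b j) atTop atTop) ∧
    -- (vii)
    (∀ t : ℝ, 0 < t → t < 1 →
      (AnisoTract.IsWTst 2 t (AnisoTract.sobolevEmbedding b) ↔
        Tendsto (fun j : ℕ => (2 * Real.pi) ^ (2 * b j) / Real.log j) atTop atTop)) ∧
    -- (viii)
    (∀ s t : ℝ, 0 < s → s < 2 → 0 < t → t ≤ 1 →
      (AnisoTract.IsWTst s t (AnisoTract.sobolevEmbedding b) ↔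
        Tendsto (fun j : ℕ => (2 * Real.pi) ^ (2 * b j) / (j : ℝ) ^ ((2 - s) / s))
          atTop atTop)) := by
  have hb1 : ∀ j : ℕ, b 1 ≤ b (j + 1) := fun j => hb_mono 1 (j + 1) le_rfl (by omega)
  have hb : ∀ j : ℕ, 0 < b (j + 1) := fun j => hb_pos.trans_le (hb1 j)
  refine ⟨fun d _ ε h0 _ => ⟨_, AnisoTract.minimalError_card_frequencies_le hb h0⟩,
    ⟨⟨AnisoTract.IsSPT.isPT, fun h => AnisoTract.isSPT_of_summable hb (h.summable hb)⟩,
      ⟨fun h => h.summable hb, fun h => (AnisoTract.isSPT_of_summable hb h).isPT⟩⟩,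
    AnisoTract.isQPT_iff hb,
    ⟨fun h => h.tendsto_div_log hb hb_mono,
      AnisoTract.isUWT_sobolevEmbedding_of_tendsto hb_pos hb1⟩, ?_, ?_, ?_, ?_, ?_⟩
  · have h1 : ((2 : ℝ) - 1) / 1 = 1 := by norm_num
    rw [AnisoTract.isWT_iff_isWTst]
    constructor
    · intro h
      simpa only [h1, Real.rpow_one] using h.tendsto_two_pi_rpow_div hb hb_mono one_pos le_rfl
    · intro h
      exact AnisoTract.isWTst_of_tendsto_of_lt_two hb_pos hb1 one_pos one_lt_two one_pos
        (by simpa only [h1, Real.rpow_one] using h)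
  · intro s t hs ht hst
    rcases lt_max_iff.1 hst with h | h
    · exact AnisoTract.isWTst_sobolevEmbedding_of_two_lt_left hb_pos hb1 (by linarith) ht
    · exact AnisoTract.isWTst_sobolevEmbedding_of_one_lt_right hb_pos hb1 hs h
  · refine ⟨fun h => ?_, AnisoTract.isWTst_two_one_of_tendsto hb_pos hb1⟩
    -- At `s = 2` the denominator is `j^0`, so the conclusion is just `c_j → ∞`, that is, `b_j → ∞`.
    have h1 := h.tendsto_two_pi_rpow_div hb hb_mono two_pos le_rfl
    simp only [sub_self, zero_div, Real.rpow_zero, div_one] at h1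
    exact AnisoTract.tendsto_two_pi_rpow_iff.1 h1
  · intro t ht ht1
    exact ⟨fun h => h.tendsto_two_pi_rpow_div_log hb hb_mono ht ht1,
      fun h => AnisoTract.isWTst_two_of_tendsto hb_pos hb1 h ht⟩
  · intro s t hs hs2 ht ht1
    exact ⟨fun h => h.tendsto_two_pi_rpow_div hb hb_mono hs ht1,
      fun h => AnisoTract.isWTst_of_tendsto_of_lt_two hb_pos hb1 hs hs2 ht h⟩
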